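/- **Setting.** Fix the security parameter $n$. A QPT algorithm is a polynomial-time uniform family of quantum circuits: from $1^n$ and, if there is one, a classical input string (a key), a classical algorithm computes in time polynomial in $n$ a quantum circuit over the gate set $\{H,T,T^\dagger,\mathrm{CNOT}\}$, which is then run on the quantum input and on ancilla qubits in the state $|0\rangle$; all but the designated output qubits are traced out. $\|\cdot\|_1$ is the trace norm (sum of the singular values), $\|\cdot\|_\diamond$ is the diamond norm, and $\nu:\mathbb N\to\mathbb R$ is negligible if $n^c\nu(n)\to0$ for every $c\in\mathbb N$. A *quantum signature scheme* $\Pi=(\mathsf{KeyGen},\mathsf{Sign},\mathsf{Ver})$ consists of QPT algorithms: $\mathsf{KeyGen}(1^n)$ outputs a pair $(\mathsf{sk},\mathsf{vk})$ of bit strings, of fixed lengths polynomially bounded in $n$; $\mathsf{Sign}_{\mathsf{sk}}$ is a channel from a register $M$ to a register $C$; and $\mathsf{Ver}_{\mathsf{vk}}$ is a channel from $C$ to $\mathcal H_M\oplus\mathbb C|\bot\rangle$. The registers $M$ and $C$ have polynomially many qubits, and $\mathcal H_M\oplus\mathbb C|\bot\rangle$ is represented in one more qubit than $M$ by $|x\rangle\mapsto|0\rangle|x\rangle$,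 $|\bot\rangle\mapsto|1\rangle|0\cdots0\rangle$. A *two-outcome projective measurement* is given by (a family, indexed by $n$, of) projectors $P$ on $\mathcal H_M\oplus\mathbb C|\bot\rangle$ that respect the direct sum, i.e. commute with $|\bot\rangle\langle\bot|$. Its measurement channel is $N(X)=\mathrm{Tr}((1-P)X)|0\rangle\langle0|+\mathrm{Tr}(PX)|1\rangle\langle1|$, and its instrument is $\tilde N(X)=(1-P)X(1-P)\otimes|0\rangle\langle0|+PXP\otimes|1\rangle\langle1|$. The instrument is *efficiently implementable* if some QPT algorithm implements it up to negligible error in diamond norm. We write $N|_M$ for $N$ restricted to operators on $\mathcal H_M$. For a finite set $\mathcal N$ of such measurements, $\Pi$ is *$\mathcal N$-correct* if there is a negligible $\nu$ such that for all $n$, all key pairs $(\mathsf{sk},\mathsf{vk})$ that $\mathsf{KeyGen}(1^n)$ outputs with positive probability, and all $N\in\mathcal N$, $$\|N\circ\mathsf{Ver}_{\mathsf{vk}}\circ\mathsf{Sign}_{\mathsf{sk}}-N|_M\|_\diamond\le\nu(n).$$ For $\varepsilon:\mathbb N\to\mathbb R$, $\Pi$ is *$\varepsilon$-one-time $\mathcal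 N$-secure* if for every QPT adversary $\mathcal A$ (given $n$ and $\mathsf{vk}$, and mapping $C$ to $C$) and every $L\in\mathcal N$ there is a negligible $\nu$ such that for every $n$ there is $p\in[0,1]$ with $$\Bigl\|L\circ\mathbb E_{(\mathsf{sk},\mathsf{vk})\leftarrow\mathsf{KeyGen}(1^n)}\bigl[\mathsf{Ver}_{\mathsf{vk}}\circ\mathcal A(\mathsf{vk})\circ\mathsf{Sign}_{\mathsf{sk}}\bigr]-\bigl(p\,L|_M+(1-p)\,L\circ\bot\bigr)\Bigr\|_\diamond\le\varepsilon(n)+\nu(n),$$ where $\bot$ is the reject map $X\mapsto\mathrm{Tr}(X)|\bot\rangle\langle\bot|$. For measurements $M_0,M_1$ with outcome registers $R_0,R_1$, let $M_1\circ M_0$ denote the map to $R_0R_1$ that first applies the instrument $\tilde M_0$ and then measures $M_1$ on the post-measurement state; $M_0\circ M_1$ is the same in the other order, and again the outcome of $M_i$ is stored in $R_i$. A family of states $\rho_{MR}$, where $R$ is a reference register, is *efficiently preparable* if some QPT algorithm without quantum input prepares it up to negligible error in trace norm. **Theorem.** Let $\Pi$ be a quantum signature scheme, and let $M_0,M_1$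 be two-outcome projective measurements with efficiently implementable instruments. If $\Pi$ is $\{M_0,M_1\}$-correct and $\varepsilon$-one-time $\{M_0,M_1\}$-secure, then there is a negligible function $\nu$ such that $$\bigl\|(M_1\circ M_0)(\rho_{MR})-(M_0\circ M_1)(\rho_{MR})\bigr\|_1\le\varepsilon(n)+\nu(n)$$ for all $n$ and all efficiently preparable families of states $\rho_{MR}$, where the measurements act on $M$ and as the identity on the reference register $R$. -/

import Mathlib

/-!
Quantum signature schemes.  Quantum polynomial-time algorithms are polynomial-time uniform families
of quantum circuits; their uniformity is witnessed by a program with an explicit cost count.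
-/

namespace QSig

open Matrix
open scoped ComplexOrder

/-! ### Classical polynomial time

Programs of a small structured language act on binary trees.  Every elementary step costs at least
the size of the tree that it acts on, so that a run of cost `t` can be carried out by a Turing
machine in time polynomial in `t` (and conversely a Turing machine is simulated, step by step, by a
`loop` whose state consists of the two halves of its tape). -/

/-- Binary trees: the data of the programs. -/
inductive Data : Type
  | nil : Data
  | cons : Data → Data → Data

/-- The number of nodes of a tree. -/
def Data.size : Data → ℕ
  | .nil => 1
  | .cons a b => a.size + b.size + 1

/-- Programs; each one computes a partial function from trees to trees. -/
inductive Prog : Type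
  | id : Prog
  | nil : Prog
  | fst : Prog
  | snd : Prog
  | pair : Prog → Prog → Prog
  | comp : Prog → Prog → Prog
  | branch : Prog → Prog → Prog → Prog
  | loop : Prog → Prog

/-- `Runs p d e t`: on the input `d` the program `p` halts with the output `e`, at cost `t`.

`pair p q` returns the two results side by side, `comp p q` runs `p` and then `q`,
`branch c p q` runs `q` if `c` returns a non-`nil` value and `p` otherwise, and `loop p` applies `p`
as long as the first component of the current value is not `nil`. -/
inductive Runs : Prog → Data → Data → ℕ → Prop
  | id (d : Data) : Runs .id d d d.size
  | nil (d : Data) : Runs .nil d .nil d.size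
  | fst_nil : Runs .fst .nil .nil Data.nil.size
  | fst_cons (a b : Data) : Runs .fst (.cons a b) a (Data.cons a b).size
  | snd_nil : Runs .snd .nil .nil Data.nil.size
  | snd_cons (a b : Data) : Runs .snd (.cons a b) b (Data.cons a b).size
  | pair {p q : Prog} {d a b : Data} {s t : ℕ} :
      Runs p d a s → Runs q d b t → Runs (.pair p q) d (.cons a b) (s + t + d.size)
  | comp {p q : Prog} {d e f : Data} {s t : ℕ} :
      Runs p d e s → Runs q e f t → Runs (.comp p q) d f (s + t + d.size)
  | branch_nil {c p q : Prog} {d e : Data} {s t : ℕ} :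
      Runs c d .nil s → Runs p d e t → Runs (.branch c p q) d e (s + t + d.size)
  | branch_cons {c p q : Prog} {d a b e : Data} {s t : ℕ} :
      Runs c d (.cons a b) s → Runs q d e t → Runs (.branch c p q) d e (s + t + d.size)
  | loop_stop {p : Prog} {d : Data} {s : ℕ} :
      Runs .fst d .nil s → Runs (.loop p) d d (s + d.size)
  | loop_step {p : Prog} {d a b e f : Data} {r s t : ℕ} :
      Runs .fst d (.cons a b) r → Runs p d e s → Runs (.loop p) e f t →
        Runs (.loop p) d f (r + s + t + d.size)

/-- Unary encoding of a natural number. -/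
def encNat : ℕ → Data
  | 0 => .nil
  | n + 1 => .cons .nil (encNat n)

/-- Encoding of a bit. -/
def encBool : Bool → Data
  | false => .nil
  | true => .cons .nil .nil

/-- Encoding of a list, given an encoding of its entries. -/
def encList {α : Type} (enc : α → Data) : List α → Data
  | [] => .nil
  | a :: l => .cons (enc a) (encList enc l)

/-! ### Quantum circuits -/

/-- Bit strings of length `n`: classical keys, and labels of the computational basis of `n`
qubits. -/
abbrev Bits (n : ℕ) : Type := Fin n → Bool

/-- Linear maps from operators on `ℂ^a` to operators on `ℂ^b`. -/
abbrev SuperOp (a b : Type) : Type := Matrix a a ℂ →ₗ[ℂ] Matrix b b ℂ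

/-- A universal gate set: Hadamard, `T`, `T†` and controlled not (control first), applied to the
wires with the given numbers. -/
inductive Gate : Type
  | had : ℕ → Gate
  | tee : ℕ → Gate
  | teeInv : ℕ → Gate
  | cnot : ℕ → ℕ → Gate

/-- A circuit: the numbers of input, ancilla and output qubits, and the gates in the order in which
they are applied. -/
structure Circuit : Type where
  inputs : ℕ
  ancillas : ℕ
  outputs : ℕ
  gates : List Gate

/-- Encoding of a gate, all numbers in unary. -/
def encGate : Gate → Data
  | .had i => .cons (encNat 0) (encNat i)
  | .tee i => .cons (encNat 1) (encNat i)
  | .teeInv i => .cons (encNat 2) (encNat i)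
  | .cnot i j => .cons (encNat 3) (.cons (encNat i) (encNat j))

/-- Encoding of a circuit, all numbers in unary. -/
def encCircuit (c : Circuit) : Data :=
  .cons (encNat c.inputs)
    (.cons (encNat c.ancillas) (.cons (encNat c.outputs) (encList encGate c.gates)))

/-- The gate refers to wires among the first `N` ones, and to two different ones if it is a
controlled not. -/
def Gate.WellFormed (N : ℕ) : Gate → Prop
  | .had i => i < N
  | .tee i => i < N
  | .teeInv i => i < N
  | .cnot i j => i < N ∧ j < N ∧ i ≠ j

/-- The unitary of a gate on `N` qubits (the identity if the gate is not well-formed). -/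
noncomputable def Gate.toMatrix (N : ℕ) : Gate → Matrix (Bits N) (Bits N) ℂ
  | .had i => if h : i < N then
      Matrix.of fun x y => if ∀ j : Fin N, j ≠ ⟨i, h⟩ → x j = y j then
        (if x ⟨i, h⟩ && y ⟨i, h⟩ then -1 else 1) / (Real.sqrt 2 : ℂ) else 0
      else 1
  | .tee i => if h : i < N then
      Matrix.diagonal fun x => if x ⟨i, h⟩ then Complex.exp (Complex.I * Real.pi / 4) else 1
      else 1
  | .teeInv i => if h : i < N then
      Matrix.diagonal fun x => if x ⟨i, h⟩ then Complex.exp (-(Complex.I * Real.pi / 4)) else 1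
      else 1
  | .cnot i j => if h : i < N ∧ j < N ∧ i ≠ j then
      Matrix.of fun x y =>
        if x = Function.update y ⟨j, h.2.1⟩ (xor (y ⟨j, h.2.1⟩) (y ⟨i, h.1⟩)) then 1 else 0
      else 1

/-- The unitary of a sequence of gates. -/
noncomputable def gatesMatrix (N : ℕ) (gs : List Gate) : Matrix (Bits N) (Bits N) ℂ :=
  gs.foldl (fun U g => g.toMatrix N * U) 1

/-- The map `X ↦ V X V†`. -/
noncomputable def conjMap {a b : Type} [Fintype a] (V : Matrix b a ℂ) : SuperOp a b where
  toFun X := V * X * Vᴴ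
  map_add' X Y := by rw [Matrix.mul_add, Matrix.add_mul]
  map_smul' z X := by rw [Matrix.mul_smul, Matrix.smul_mul, RingHom.id_apply]

/-- The isometry that appends `k` qubits in the state `|0⟩`. -/
def addAncillas (a k : ℕ) : Matrix (Bits (a + k)) (Bits a) ℂ :=
  Matrix.of fun y x => if y = Fin.append x (fun _ => false) then 1 else 0

/-- The basis label of `N` qubits whose first `b` bits are `x` and whose other bits are `e`. -/
def joinBits (N b : ℕ) (x : Bits b) (e : Bits (N - b)) : Bits N :=
  fun i => if h : i.val < b then x ⟨i.val, h⟩ else e ⟨i.val - b, by omega⟩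

/-- Keep the first `b` of `N` qubits and trace out the others (for `b ≤ N`). -/
noncomputable def keepFirst (N b : ℕ) : SuperOp (Bits N) (Bits b) where
  toFun X := Matrix.of fun x y => ∑ e : Bits (N - b), X (joinBits N b x e) (joinBits N b y e)
  map_add' X Y := by
    ext x y; simp [Finset.sum_add_distrib]
  map_smul' z X := by
    ext x y; simp [Finset.mul_sum]

/-- The circuit is well-formed, and takes `a` qubits to `b` qubits. -/
def Circuit.HasShape (c : Circuit) (a b : ℕ) : Prop :=
  c.inputs = a ∧ c.outputs = b ∧ b ≤ a + c.ancillas ∧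
    ∀ g ∈ c.gates, g.WellFormed (a + c.ancillas)

/-- The channel of a circuit from `a` to `b` qubits: append the ancillas in the state `|0⟩`, apply
the gates, keep the first `b` qubits and trace out the rest. -/
noncomputable def Circuit.channel (c : Circuit) (a b : ℕ) : SuperOp (Bits a) (Bits b) :=
  keepFirst (a + c.ancillas) b ∘ₗ
    conjMap (gatesMatrix (a + c.ancillas) c.gates * addAncillas a c.ancillas)

/-! ### Efficient quantum algorithms -/

/-- The function `ν` is negligible: `n ^ c * ν n → 0` for every `c`. -/
def Negligible (ν : ℕ → ℝ) : Prop :=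
  Asymptotics.SuperpolynomialDecay Filter.atTop (fun n : ℕ => (n : ℝ)) ν

/-- The circuit `C n k` is computed from `1^n` and the bit string `k` in time polynomial in `n`. -/
def PolyTimeUniform {l : ℕ → ℕ} (C : ∀ n, Bits (l n) → Circuit) : Prop :=
  ∃ (p : Prog) (q : Polynomial ℕ), ∀ (n : ℕ) (k : Bits (l n)), ∃ t : ℕ, t ≤ q.eval n ∧
    Runs p (.cons (encNat n) (encList encBool (List.ofFn k))) (encCircuit (C n k)) t

/-- The circuit `C n` is computed from `1^n` in time polynomial in `n`. -/
def PolyTimeUniform₀ (C : ℕ → Circuit) : Prop :=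
  PolyTimeUniform (l := fun _ => 0) (fun n _ => C n)

/-- The maps `Φ n k`, from `a n` to `b n` qubits, are implemented by a quantum polynomial-time
algorithm that gets the security parameter `n` and the classical string `k`. -/
def IsQPT {l a b : ℕ → ℕ} (Φ : ∀ n, Bits (l n) → SuperOp (Bits (a n)) (Bits (b n))) : Prop :=
  ∃ C : ∀ n, Bits (l n) → Circuit, PolyTimeUniform C ∧
    ∀ n k, (C n k).HasShape (a n) (b n) ∧ (C n k).channel (a n) (b n) = Φ n k

/-! ### Norms -/

/-- The trace norm: the sum of the singular values. -/
noncomputable def traceNorm {a : Type} [Fintype a] [DecidableEq a] (X : Matrix a a ℂ) : ℝ :=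
  ∑ i, Real.sqrt ((Matrix.isHermitian_conjTranspose_mul_self X).eigenvalues i)

/-- The map `Φ ⊗ id` with a reference system `k`. -/
def ampliate {a b : Type} (k : Type) (Φ : SuperOp a b) : SuperOp (a × k) (b × k) where
  toFun X := Matrix.of fun i j =>
    Φ (Matrix.of fun i' j' => X (i', i.2) (j', j.2)) i.1 j.1
  map_add' X Y := by
    ext i j
    exact congrFun (congrFun (map_add Φ (Matrix.of fun i' j' => X (i', i.2) (j', j.2))
      (Matrix.of fun i' j' => Y (i', i.2) (j', j.2))) i.1) j.1
  map_smul' z X := by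
    ext i j
    exact congrFun (congrFun (map_smul Φ z (Matrix.of fun i' j' => X (i', i.2) (j', j.2))) i.1) j.1

/-- `‖Φ‖_⋄ ≤ δ`, where `‖Φ‖_⋄` is the supremum of `‖(Φ ⊗ id_k) X‖₁` over all finite-dimensional
reference systems `k` and all `X` with `‖X‖₁ ≤ 1`. -/
def DiamondNormLE {a b : Type} [Fintype a] [DecidableEq a] [Fintype b] [DecidableEq b]
    (Φ : SuperOp a b) (δ : ℝ) : Prop :=
  ∀ (k : ℕ) (X : Matrix (a × Fin k) (a × Fin k) ℂ),
    traceNorm X ≤ 1 → traceNorm (ampliate (Fin k) Φ X) ≤ δ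

/-! ### The space `H_M ⊕ ⊥` -/

/-- Labels of the basis of `H_M ⊕ ⊥`, where `H_M` consists of `m` qubits: `none` stands for `⊥`. -/
abbrev Rej (m : ℕ) : Type := Option (Bits m)

/-- Representation of `H_M ⊕ ⊥` in `m + 1` qubits, the first of which is the reject flag:
`|x⟩` is `|0⟩|x⟩`, and `⊥` is `|1⟩|0…0⟩`. -/
def encodeRej (m : ℕ) : Rej m → Bits (m + 1)
  | some x => Fin.cons false x
  | none => Fin.cons true (fun _ => false)

/-- The isometry that maps the basis vector `|x⟩` to `|f x⟩` (for an injective `f`). -/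
def basisMap {a b : Type} [DecidableEq b] (f : a → b) : Matrix b a ℂ :=
  Matrix.of fun y x => if y = f x then 1 else 0

/-- The embedding of the operators on `H_M` into those on `H_M ⊕ ⊥`. -/
noncomputable def inclusion (m : ℕ) : SuperOp (Bits m) (Rej m) :=
  conjMap (basisMap some)

/-- The reject map `X ↦ Tr(X) |⊥⟩⟨⊥|`. -/
noncomputable def rejectMap (m : ℕ) : SuperOp (Bits m) (Rej m) where
  toFun X := X.trace • Matrix.single none none 1
  map_add' X Y := by rw [Matrix.trace_add, add_smul]
  map_smul' z X := by rw [Matrix.trace_smul, smul_assoc, RingHom.id_apply]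

/-! ### Two-outcome measurements -/

section Measurements

variable {a : Type} [Fintype a] [DecidableEq a]

/-- The projector of the outcome `r`, if `P` is the projector of the outcome `1`. -/
def outcomeProj (P : Matrix a a ℂ) (r : Bool) : Matrix a a ℂ :=
  if r then P else 1 - P

/-- The measurement channel `X ↦ Tr((1 - P) X) |0⟩⟨0| + Tr(P X) |1⟩⟨1|`. -/
noncomputable def outcomeMap (P : Matrix a a ℂ) : SuperOp a Bool where
  toFun X := Matrix.diagonal fun r => (outcomeProj P r * X).trace
  map_add' X Y := by
    rw [Matrix.diagonal_add]
    simp [Matrix.mul_add, Matrix.trace_add]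
  map_smul' z X := by
    rw [RingHom.id_apply, ← Matrix.diagonal_smul]
    congr 1
    funext r
    simp [Matrix.trace_smul]

/-- The instrument `X ↦ (1 - P) X (1 - P) ⊗ |0⟩⟨0| + P X P ⊗ |1⟩⟨1|`. -/
noncomputable def instrument (P : Matrix a a ℂ) : SuperOp a (a × Bool) where
  toFun X := Matrix.of fun i j =>
    if i.2 = j.2 then (outcomeProj P i.2 * X * outcomeProj P i.2) i.1 j.1 else 0
  map_add' X Y := by
    ext i j
    by_cases h : i.2 = j.2 <;> simp [h, Matrix.mul_add, Matrix.add_mul]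
  map_smul' z X := by
    ext i j
    by_cases h : i.2 = j.2 <;> simp [h]

/-- Measure `P` first and then `Q` on the post-measurement state.  The output consists of the
outcome of `Q` and the outcome of `P`, in this order. -/
noncomputable def measureThen (P Q : Matrix a a ℂ) : SuperOp a (Bool × Bool) :=
  ampliate Bool (outcomeMap Q) ∘ₗ instrument P

/-- Exchange of the two registers. -/
def swapRegisters : SuperOp (Bool × Bool) (Bool × Bool) where
  toFun X := X.submatrix Prod.swap Prod.swap
  map_add' _ _ := rfl
  map_smul' _ _ := rfl

/-- `M₁ ∘ M₀`, for the measurements given by `P₀` and `P₁`: first `M₀`, then `M₁`.  The output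
registers are `R₀ R₁`, where `R_i` holds the outcome of `M_i`. -/
noncomputable def zeroThenOne (P₀ P₁ : Matrix a a ℂ) : SuperOp a (Bool × Bool) :=
  swapRegisters ∘ₗ measureThen P₀ P₁

/-- `M₀ ∘ M₁`: first `M₁`, then `M₀`.  The output registers are `R₀ R₁`, where `R_i` holds the
outcome of `M_i`. -/
noncomputable def oneThenZero (P₀ P₁ : Matrix a a ℂ) : SuperOp a (Bool × Bool) :=
  measureThen P₁ P₀

end Measurements

/-- A family of two-outcome projective measurements of a message of `m n` qubits, extended to
`H_M ⊕ ⊥`: for each `n` a projector on `H_M ⊕ ⊥` that respects the direct sum, that is, commutes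
with `|⊥⟩⟨⊥|`.  (So it is a projector on `H_M` plus `0` or `1` times `|⊥⟩⟨⊥|`.) -/
structure TwoOutcome (m : ℕ → ℕ) : Type where
  proj : ∀ n, Matrix (Rej (m n)) (Rej (m n)) ℂ
  isStarProjection : ∀ n, IsStarProjection (proj n)
  commute_reject : ∀ n, Commute (proj n) (Matrix.single none none 1)

/-- The instrument of the measurement is implemented, up to a negligible error in the diamond norm,
by a quantum polynomial-time algorithm.  The outcome is the first output qubit. -/
def TwoOutcome.EfficientInstrument {m : ℕ → ℕ} (M : TwoOutcome m) : Prop :=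
  ∃ C : ℕ → Circuit, PolyTimeUniform₀ C ∧ ∃ ν : ℕ → ℝ, Negligible ν ∧
    ∀ n, (C n).HasShape (m n + 1) (m n + 1 + 1) ∧
      DiamondNormLE
        ((C n).channel (m n + 1) (m n + 1 + 1) ∘ₗ conjMap (basisMap (encodeRej (m n))) -
          conjMap (basisMap fun x : Rej (m n) × Bool =>
              (Fin.cons x.2 (encodeRej (m n) x.1) : Bits (m n + 1 + 1))) ∘ₗ
            instrument (M.proj n))
        (ν n)

/-- The states `ρ n`, on `m n` message qubits and `r n` reference qubits, are efficiently
preparable: up to a negligible error in trace norm they are the output of a quantum polynomial-time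
algorithm without quantum input. -/
def EfficientlyPreparable (m r : ℕ → ℕ)
    (ρ : ∀ n, Matrix (Bits (m n) × Bits (r n)) (Bits (m n) × Bits (r n)) ℂ) : Prop :=
  (∀ n, (ρ n).PosSemidef ∧ (ρ n).trace = 1) ∧
  ∃ C : ℕ → Circuit, PolyTimeUniform₀ C ∧ ∃ ν : ℕ → ℝ, Negligible ν ∧
    ∀ n, (C n).HasShape 0 (m n + r n) ∧
      traceNorm (((C n).channel 0 (m n + r n) 1).submatrix
        (fun x : Bits (m n) × Bits (r n) => Fin.append x.1 x.2)
        (fun x : Bits (m n) × Bits (r n) => Fin.append x.1 x.2) - ρ n) ≤ ν n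

/-! ### Quantum signature schemes -/

/-- A quantum signature scheme.  The register `M` has `m n` qubits, the register `C` has `c n`
qubits, signing keys have `ls n` bits and verification keys `lv n` bits.  These numbers are bounded
by polynomials, because they are written in unary in circuits that are computed in polynomial
time. -/
structure Scheme : Type where
  m : ℕ → ℕ
  c : ℕ → ℕ
  ls : ℕ → ℕ
  lv : ℕ → ℕ
  /-- The joint distribution of the signing key and the verification key. -/
  keyGen : ∀ n, PMF (Bits (ls n) × Bits (lv n))
  sign : ∀ n, Bits (ls n) → SuperOp (Bits (m n)) (Bits (c n))
  ver : ∀ n, Bits (lv n) → SuperOp (Bits (c n)) (Rej (m n))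
  /-- Key generation is a quantum polynomial-time algorithm whose output is measured in the
  computational basis. -/
  keyGen_qpt : ∃ C : ℕ → Circuit, PolyTimeUniform₀ C ∧ ∀ n, (C n).HasShape 0 (ls n + lv n) ∧
    ∀ sk vk, (C n).channel 0 (ls n + lv n) 1 (Fin.append sk vk) (Fin.append sk vk) =
      (((keyGen n (sk, vk)).toReal : ℝ) : ℂ)
  sign_qpt : IsQPT sign
  ver_qpt : IsQPT (b := fun n => m n + 1)
    (fun n vk => conjMap (basisMap (encodeRej (m n))) ∘ₗ ver n vk)

/-- The scheme is correct for a set of two-outcome measurements: for every key pair that key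
generation can output, and every measurement `N` of the set,
`‖N ∘ Ver_vk ∘ Sign_sk - N‖_⋄` is at most negligible, where the last `N` acts on `H_M`. -/
def Scheme.CorrectFor (S : Scheme) (𝒩 : Set (TwoOutcome S.m)) : Prop :=
  ∃ ν : ℕ → ℝ, Negligible ν ∧ ∀ N ∈ 𝒩, ∀ n, ∀ k ∈ (S.keyGen n).support,
    DiamondNormLE
      (outcomeMap (N.proj n) ∘ₗ S.ver n k.2 ∘ₗ S.sign n k.1 -
        outcomeMap (N.proj n) ∘ₗ inclusion (S.m n))
      (ν n)

/-- The average `E[Ver_vk ∘ A(vk) ∘ Sign_sk]` over the key pairs. -/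
noncomputable def Scheme.attack (S : Scheme) (n : ℕ)
    (A : Bits (S.lv n) → SuperOp (Bits (S.c n)) (Bits (S.c n))) :
    SuperOp (Bits (S.m n)) (Rej (S.m n)) :=
  ∑ k : Bits (S.ls n) × Bits (S.lv n),
    (((S.keyGen n k).toReal : ℝ) : ℂ) • (S.ver n k.2 ∘ₗ A k.2 ∘ₗ S.sign n k.1)

/-- The scheme is `ε`-one-time secure for a set of two-outcome measurements: for every quantum
polynomial-time adversary `A` and every measurement `L` of the set there are probabilities `p` with
`‖L ∘ E[Ver_vk ∘ A(vk) ∘ Sign_sk] - (p L + (1 - p) L ∘ ⊥)‖_⋄ ≤ ε`, up to a negligible error. -/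
def Scheme.OneTimeSecureFor (S : Scheme) (ε : ℕ → ℝ) (ℒ : Set (TwoOutcome S.m)) : Prop :=
  ∀ A : ∀ n, Bits (S.lv n) → SuperOp (Bits (S.c n)) (Bits (S.c n)), IsQPT A →
    ∀ L ∈ ℒ, ∃ ν : ℕ → ℝ, Negligible ν ∧ ∀ n, ∃ p : ℝ, 0 ≤ p ∧ p ≤ 1 ∧
      DiamondNormLE
        (outcomeMap (L.proj n) ∘ₗ S.attack n (A n) -
          ((p : ℂ) • (outcomeMap (L.proj n) ∘ₗ inclusion (S.m n)) +
            ((1 - p : ℝ) : ℂ) • (outcomeMap (L.proj n) ∘ₗ rejectMap (S.m n))))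
        (ε n + ν n)

end QSig

open QSig

/-! Write `P`, `Q` for the projectors of `M₀`, `M₁` compressed to the message space, and `O₀ = 2P -
1`, `O₁ = 2Q - 1` for their reflections. The proof turns `O₀` into an attack. The adversary verifies
coherently, runs the instrument of `M₀` coherently, flips the sign on outcome `1`, and undoes
everything. Correctness makes this act on signed states like `-O₀` applied to the message before
signing, so verifying and then measuring `M₁` yields the observable `O₀ O₁ O₀` up to negligible
error (`exists_attack_observable`). Security says that this observable is within `ε + negl` of `p O₁
+ (1 - p) o`, where `o = ±1` is the value of `M₁` on `⊥`.

The mixture costs nothing (`norm_conj_sub_le_of_mixture`). Put `H = O₀ O₁ O₀ - O₁`. Since `-1 ≤ O₁ ≤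
1`, replacing part of `O₁` by the constant `o` moves it in one direction only, which leaves a
one-sided bound on `H`; and `O₀ H O₀ = -H` turns this into the other one. Hence `‖H‖ ≤ ε + negl`,
whatever `p` is.

The constants match exactly. From `H O₀ = [O₀, O₁] = 4 [P, Q]` comes `4 ‖[P, Q]‖ ≤ ‖H‖`. The two
orders of measurement differ by the operators `PQP - QPQ`, one for each of the four outcome pairs
(with complements of `P`, `Q` where needed), each of norm at most `‖[P, Q]‖`, so their trace
distance is at most `4 ‖[P, Q]‖` for every state (`traceNorm_measure_orders_le`).

All error estimates are made in the Heisenberg picture: a diamond norm bound becomes an operator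
norm bound on pulled-back observables (`DiamondNormLE.norm_le`). Correctness and the instrument
control outcome statistics, whereas the attack needs statements about isometries.
`norm_sub_mul_le_of_overlap` bridges this: two isometries whose overlap is nearly unitary nearly
agree up to that unitary, at the price of a square root, which keeps errors negligible. That the
attack is an efficient algorithm is proved by writing its circuit transformation as a program
(`polyTimeUniform_attackCircuit`). -/

namespace QSig

set_option linter.unusedSectionVars false

open Matrix
open scoped ComplexOrder Matrix.Norms.L2Operator

/-! ### Duality of the trace norm and the operator norm. -/

section TraceNorm

variable {a b : Type} [Fintype a] [DecidableEq a] [Fintype b] [DecidableEq b]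

/-- The trace is evaluated in an eigenbasis of `Xᴴ * X`, whose vectors `X` maps to vectors of length
equal to the singular values. -/
theorem norm_trace_mul_le (B X : Matrix a a ℂ) : ‖(B * X).trace‖ ≤ ‖B‖ * traceNorm X := by
  have hH := Matrix.isHermitian_conjTranspose_mul_self X
  have htr : (B * X).trace = ∑ i, inner ℂ (hH.eigenvectorBasis i)
      (toEuclideanCLM (𝕜 := ℂ) (B * X) (hH.eigenvectorBasis i)) := by
    refine Eq.trans ?_ (LinearMap.trace_eq_sum_inner (toEuclideanLin (𝕜 := ℂ) (B * X))
      hH.eigenvectorBasis)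
    rw [toEuclideanLin_eq_toLin_orthonormal, LinearMap.trace_eq_matrix_trace ℂ
      (EuclideanSpace.basisFun a ℂ).toBasis, LinearMap.toMatrix_toLin]
  have hcol : ∀ i, ‖toEuclideanCLM (𝕜 := ℂ) X (hH.eigenvectorBasis i)‖ =
      Real.sqrt (hH.eigenvalues i) := by
    intro i
    have hev : toEuclideanCLM (𝕜 := ℂ) (star X * X) (hH.eigenvectorBasis i) =
        (hH.eigenvalues i : ℂ) • hH.eigenvectorBasis i := by
      have := hH.mulVec_eigenvectorBasis i
      apply (WithLp.ofLp_injective 2)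
      simp only [ofLp_toEuclideanCLM, WithLp.ofLp_smul]
      exact this
    have h := ContinuousLinearMap.apply_norm_sq_eq_inner_adjoint_right
      (toEuclideanCLM (𝕜 := ℂ) X) (hH.eigenvectorBasis i)
    have h2 : (ContinuousLinearMap.adjoint (toEuclideanCLM (𝕜 := ℂ) X) ∘L
        toEuclideanCLM (𝕜 := ℂ) X) = toEuclideanCLM (𝕜 := ℂ) (star X * X) := by
      rw [map_mul, map_star]; rfl
    rw [← Real.sqrt_sq (norm_nonneg _), h, h2, hev,
      inner_smul_right, inner_self_eq_norm_sq_to_K]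
    simp
  rw [htr, traceNorm, Finset.mul_sum]
  refine (norm_sum_le _ _).trans (Finset.sum_le_sum fun i _ => ?_)
  refine (norm_inner_le_norm _ _).trans ?_
  rw [hH.eigenvectorBasis.orthonormal.1 i, one_mul, map_mul, ← hcol i]
  exact (toEuclideanCLM (𝕜 := ℂ) B).le_opNorm _

/-- The polar decomposition supplies `U`: it is `(Xᴴ X)^(-1/2) Xᴴ`, with the inverse root taken on
the support. -/
theorem exists_traceNorm_eq_trace (X : Matrix a a ℂ) :
    ∃ U : Matrix a a ℂ, ‖U‖ ≤ 1 ∧ (U * X).trace = (traceNorm X : ℂ) := by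
  have hH := Matrix.isHermitian_conjTranspose_mul_self X
  set W : Matrix a a ℂ := (hH.eigenvectorUnitary : Matrix a a ℂ) with hW
  set lam := hH.eigenvalues with hlam
  have hWW : star W * W = 1 := Unitary.coe_star_mul_self hH.eigenvectorUnitary
  have hspec : Xᴴ * X = W * diagonal (fun i => (lam i : ℂ)) * star W := by
    have := hH.spectral_theorem
    rw [Unitary.conjStarAlgAut_apply] at this
    exact this
  have hnn : ∀ i, 0 ≤ lam i := (Matrix.posSemidef_conjTranspose_mul_self X).eigenvalues_nonneg
  -- On the kernel of `X` the convention `0⁻¹ = 0` gives the pseudo-inverse.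
  set d : a → ℂ := fun i => (((Real.sqrt (lam i))⁻¹ : ℝ) : ℂ) with hd
  set D : Matrix a a ℂ := diagonal d with hD
  have hDs : Dᴴ = D := by
    rw [hD, diagonal_conjTranspose]; congr 1; ext i; simp [hd]
  refine ⟨W * D * star W * Xᴴ, ?_, ?_⟩
  · have h1 : ‖(W * D * star W * Xᴴ)ᴴ‖ * ‖(W * D * star W * Xᴴ)ᴴ‖ ≤ 1 := by
      rw [← l2_opNorm_conjTranspose_mul_self, conjTranspose_conjTranspose]
      have : W * D * star W * Xᴴ * (W * D * star W * Xᴴ)ᴴ =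
          W * (D * diagonal (fun i => (lam i : ℂ)) * D) * star W := by
        have hWs : (star W)ᴴ = W := star_star W
        simp only [conjTranspose_mul, conjTranspose_conjTranspose, hDs, hWs]
        calc W * D * star W * Xᴴ * (X * (W * (D * Wᴴ)))
            = W * D * star W * (Xᴴ * X) * (W * (D * star W)) := by
              simp only [Matrix.mul_assoc, star_eq_conjTranspose]
          _ = W * D * (star W * W) * diagonal (fun i => (lam i : ℂ)) * (star W * W)
                * D * star W := by
              rw [hspec]; simp only [Matrix.mul_assoc]
          _ = _ := by rw [hWW]; simp only [Matrix.mul_assoc, Matrix.mul_one]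
      rw [this]
      have hWn : ‖W‖ ≤ 1 := by
        have h := l2_opNorm_conjTranspose_mul_self W
        rw [← star_eq_conjTranspose, hWW] at h
        have h1 : ‖(1 : Matrix a a ℂ)‖ ≤ 1 := by
          rw [← diagonal_one, l2_opNorm_diagonal]
          exact (pi_norm_le_iff_of_nonneg zero_le_one).2 fun i => by simp
        nlinarith [norm_nonneg W]
      have hdiag : ‖D * diagonal (fun i => (lam i : ℂ)) * D‖ ≤ 1 := by
        rw [hD, diagonal_mul_diagonal, diagonal_mul_diagonal, l2_opNorm_diagonal]
        refine (pi_norm_le_iff_of_nonneg zero_le_one).2 fun i => ?_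
        simp only [hd, ← Complex.ofReal_mul, Complex.norm_real, Real.norm_eq_abs]
        rcases eq_or_lt_of_le (hnn i) with h | h
        · simp [← h]
        · have hs : 0 < Real.sqrt (lam i) := Real.sqrt_pos.2 h
          have : (Real.sqrt (lam i))⁻¹ * lam i * (Real.sqrt (lam i))⁻¹ = 1 := by
            field_simp
            rw [Real.sq_sqrt h.le]
          rw [this]; simp
      calc _ ≤ ‖W‖ * ‖D * diagonal (fun i => (lam i : ℂ)) * D‖ * ‖star W‖ :=
            norm_mul₃_le
        _ ≤ 1 * 1 * 1 := by
            rw [norm_star]; gcongr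
        _ = 1 := by norm_num
    rw [l2_opNorm_conjTranspose] at h1
    nlinarith [norm_nonneg (W * D * star W * Xᴴ)]
  · have : W * D * star W * Xᴴ * X = W * (D * diagonal (fun i => (lam i : ℂ))) * star W := by
      calc _ = W * D * star W * (Xᴴ * X) := by simp only [Matrix.mul_assoc]
        _ = W * D * (star W * W) * diagonal (fun i => (lam i : ℂ)) * star W := by
          rw [hspec]; simp only [Matrix.mul_assoc]
        _ = _ := by rw [hWW]; simp only [Matrix.mul_assoc, Matrix.mul_one]
    rw [this, trace_mul_comm, ← Matrix.mul_assoc, hWW, Matrix.one_mul, hD, diagonal_mul_diagonal,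
      trace_diagonal, traceNorm]
    push_cast
    refine Finset.sum_congr rfl fun i _ => ?_
    simp only [hd, ← Complex.ofReal_mul, ← hlam]
    congr 1
    rcases eq_or_lt_of_le (hnn i) with h | h
    · simp [← h]
    · have hs : 0 < Real.sqrt (lam i) := Real.sqrt_pos.2 h
      field_simp
      rw [Real.sq_sqrt h.le]

theorem traceNorm_nonneg (X : Matrix a a ℂ) : 0 ≤ traceNorm X :=
  Finset.sum_nonneg fun _ _ => Real.sqrt_nonneg _

theorem traceNorm_le_of_forall {X : Matrix a a ℂ} {δ : ℝ}
    (h : ∀ U : Matrix a a ℂ, ‖U‖ ≤ 1 → ‖(U * X).trace‖ ≤ δ) : traceNorm X ≤ δ := by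
  obtain ⟨U, hU, hX⟩ := exists_traceNorm_eq_trace X
  have := h U hU
  rw [hX, Complex.norm_real, Real.norm_of_nonneg (traceNorm_nonneg X)] at this
  exact this

theorem traceNorm_vecMulVec_le (u v : EuclideanSpace ℂ a) :
    traceNorm (vecMulVec u.ofLp (star v.ofLp)) ≤ ‖u‖ * ‖v‖ := by
  refine traceNorm_le_of_forall fun U hU => ?_
  have : (U * vecMulVec u.ofLp (star v.ofLp)).trace =
      inner ℂ v (toEuclideanCLM (𝕜 := ℂ) U u) := by
    rw [mul_vecMulVec, trace_vecMulVec, EuclideanSpace.inner_eq_star_dotProduct]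
    rfl
  rw [this]
  refine (norm_inner_le_norm _ _).trans ?_
  rw [mul_comm]
  gcongr
  calc _ ≤ ‖U‖ * ‖u‖ := (toEuclideanCLM (𝕜 := ℂ) U).le_opNorm u
    _ ≤ 1 * ‖u‖ := by gcongr
    _ = _ := one_mul _

theorem traceNorm_smul_le (z : ℂ) (X : Matrix a a ℂ) : traceNorm (z • X) ≤ ‖z‖ * traceNorm X := by
  refine traceNorm_le_of_forall fun U hU => ?_
  rw [Matrix.mul_smul, trace_smul, norm_smul]
  gcongr
  exact (norm_trace_mul_le U X).trans (mul_le_of_le_one_left (traceNorm_nonneg X) hU)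

/-- The operator norm is dual to the trace norm. -/
theorem norm_le_of_forall_trace {D : Matrix a a ℂ} {δ : ℝ}
    (h : ∀ X, traceNorm X ≤ 1 → ‖(D * X).trace‖ ≤ δ) : ‖D‖ ≤ δ := by
  have hδ : 0 ≤ δ := by simpa using (norm_nonneg _).trans (h 0 (by
    simpa using traceNorm_smul_le (0 : ℂ) (0 : Matrix a a ℂ) |>.trans (by simp)))
  rw [← l2_opNorm_toEuclideanCLM]
  refine ContinuousLinearMap.opNorm_le_bound _ hδ fun u => ?_
  set y := toEuclideanCLM (𝕜 := ℂ) D u with hy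
  rcases eq_or_ne u 0 with hu | hu
  · rw [hy, hu]; simp
  rcases eq_or_ne y 0 with hy0 | hy0
  · rw [hy0, norm_zero]; positivity
  have hu' : 0 < ‖u‖ := norm_pos_iff.2 hu
  have hy' : 0 < ‖y‖ := norm_pos_iff.2 hy0
  -- The test operator is the normalized rank-one operator `u y*` with `y = D u`, for which `tr (D u
  -- y*) = ‖y‖²`.
  have key := h (((‖u‖ * ‖y‖ : ℝ) : ℂ)⁻¹ • vecMulVec u.ofLp (star y.ofLp)) (by
    refine (traceNorm_smul_le _ _).trans ?_
    rw [norm_inv, Complex.norm_real, Real.norm_of_nonneg (by positivity),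
      inv_mul_le_iff₀ (by positivity), mul_one]
    exact traceNorm_vecMulVec_le u y)
  have htr : (D * vecMulVec u.ofLp (star y.ofLp)).trace = inner ℂ y y := by
    rw [mul_vecMulVec, trace_vecMulVec, EuclideanSpace.inner_eq_star_dotProduct]
    rfl
  rw [Matrix.mul_smul, trace_smul, norm_smul, htr, inner_self_eq_norm_sq_to_K, norm_inv,
    Complex.norm_real, Real.norm_of_nonneg (by positivity), inv_mul_le_iff₀ (by positivity)] at key
  simp only [Complex.coe_algebraMap, norm_pow, Complex.norm_real, norm_norm] at key
  nlinarith

end TraceNorm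

/-! ### Operator norm estimates for isometries. -/

section OperatorNorm

variable {a b c d : Type} [Fintype a] [DecidableEq a] [Fintype b] [DecidableEq b]
  [Fintype c] [DecidableEq c] [Fintype d] [DecidableEq d]

theorem norm_one_le : ‖(1 : Matrix a a ℂ)‖ ≤ 1 := by
  rw [← diagonal_one, l2_opNorm_diagonal]
  exact (pi_norm_le_iff_of_nonneg zero_le_one).2 fun i => by simp

theorem norm_le_one_of_isometry {A : Matrix a b ℂ} (h : Aᴴ * A = 1) : ‖A‖ ≤ 1 := by
  have h1 := l2_opNorm_conjTranspose_mul_self A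
  rw [h] at h1
  have h2 := norm_one_le (a := b)
  nlinarith [norm_nonneg A]

/-- On square matrices `B ↦ B ⊗ 1` is a star homomorphism, hence contractive; applying it to `Aᴴ *
A`, the C*-identity covers rectangular `A`. -/
theorem norm_kronecker_one_le (A : Matrix a b ℂ) :
    ‖(kroneckerMap (· * ·) A (1 : Matrix c c ℂ))‖ ≤ ‖A‖ := by
  let φ : Matrix b b ℂ →⋆ₙₐ[ℂ] Matrix (b × c) (b × c) ℂ :=
    { toFun := fun B => kroneckerMap (· * ·) B 1
      map_smul' := fun z B => smul_kronecker z B 1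
      map_zero' := zero_kronecker 1
      map_add' := fun B C => add_kronecker B C 1
      map_mul' := fun B C => by rw [← mul_kronecker_mul, Matrix.one_mul]
      map_star' := fun B => by
        simp only [star_eq_conjTranspose, conjTranspose_kronecker, conjTranspose_one] }
  have h1 := NonUnitalStarAlgHom.norm_apply_le φ (Aᴴ * A)
  have h2 : φ (Aᴴ * A) = (kroneckerMap (· * ·) A (1 : Matrix c c ℂ))ᴴ *
      kroneckerMap (· * ·) A (1 : Matrix c c ℂ) := by
    rw [conjTranspose_kronecker, ← mul_kronecker_mul, conjTranspose_one, Matrix.one_mul]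
    rfl
  rw [h2, l2_opNorm_conjTranspose_mul_self, l2_opNorm_conjTranspose_mul_self] at h1
  exact abs_le_of_sq_le_sq' (by nlinarith) (norm_nonneg _) |>.2

/-- Two isometries whose overlap is close to a unitary are close up to this unitary. -/
theorem norm_sub_mul_le_of_overlap {A B : Matrix a b ℂ} {O : Matrix b b ℂ} {ν : ℝ}
    (hA : Aᴴ * A = 1) (hB : Bᴴ * B = 1) (hO : Oᴴ * O = 1) (h : ‖Bᴴ * A - O‖ ≤ ν) :
    ‖A - B * O‖ ≤ Real.sqrt (2 * ν) := by
  apply Real.le_sqrt_of_sq_le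
  rw [sq, ← l2_opNorm_conjTranspose_mul_self]
  -- Both squares contribute `1 = Oᴴ * O`, which absorbs the cross terms into deviations of the
  -- overlap from `O`.
  have : (A - B * O)ᴴ * (A - B * O) = -((Bᴴ * A - O)ᴴ * O + Oᴴ * (Bᴴ * A - O)) := by
    have e1 : Oᴴ * Bᴴ * (B * O) = 1 := by
      rw [Matrix.mul_assoc, ← Matrix.mul_assoc Bᴴ, hB, Matrix.one_mul, hO]
    simp only [conjTranspose_sub, conjTranspose_mul, Matrix.sub_mul, Matrix.mul_sub, hA, e1,
      conjTranspose_conjTranspose, hO, Matrix.mul_assoc]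
    abel
  rw [this, norm_neg]
  have hOn := norm_le_one_of_isometry hO
  have h0 := norm_nonneg (Bᴴ * A - O)
  calc _ ≤ ‖(Bᴴ * A - O)ᴴ * O‖ + ‖Oᴴ * (Bᴴ * A - O)‖ := norm_add_le _ _
    _ ≤ ‖(Bᴴ * A - O)ᴴ‖ * ‖O‖ + ‖Oᴴ‖ * ‖Bᴴ * A - O‖ := by gcongr <;> exact norm_mul_le _ _
    _ ≤ ν * 1 + 1 * ν := by
      rw [l2_opNorm_conjTranspose, l2_opNorm_conjTranspose]; gcongr; exact h0.trans h
    _ = 2 * ν := by ring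

theorem norm_sandwich_sub_le {A B : Matrix a b ℂ} {E : Matrix a a ℂ} {η : ℝ}
    (hA : ‖A‖ ≤ 1) (hB : ‖B‖ ≤ 1) (hE : ‖E‖ ≤ 1) (h : ‖A - B‖ ≤ η) :
    ‖Aᴴ * E * A - Bᴴ * E * B‖ ≤ 2 * η := by
  have : Aᴴ * E * A - Bᴴ * E * B = Aᴴ * (E * (A - B)) + (A - B)ᴴ * (E * B) := by
    simp only [conjTranspose_sub, Matrix.sub_mul, Matrix.mul_sub, Matrix.mul_assoc]; abel
  rw [this]
  have h0 : 0 ≤ η := (norm_nonneg _).trans h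
  calc _ ≤ ‖Aᴴ * (E * (A - B))‖ + ‖(A - B)ᴴ * (E * B)‖ := norm_add_le _ _
    _ ≤ ‖Aᴴ‖ * (‖E‖ * ‖A - B‖) + ‖(A - B)ᴴ‖ * (‖E‖ * ‖B‖) := by
      gcongr
      · exact (l2_opNorm_mul _ _).trans (by gcongr; exact l2_opNorm_mul _ _)
      · exact (l2_opNorm_mul _ _).trans (by gcongr; exact l2_opNorm_mul _ _)
    _ ≤ 1 * (1 * η) + η * (1 * 1) := by
      rw [l2_opNorm_conjTranspose, l2_opNorm_conjTranspose]
      gcongr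
    _ = 2 * η := by ring

end OperatorNorm

/-! ### Projections and reflections in C*-algebras. -/

section SelfAdjoint

theorem norm_le_of_le_of_neg_le {A : Type*} [CStarAlgebra A] [PartialOrder A] [StarOrderedRing A]
    {H : A} (hH : IsSelfAdjoint H) {δ : ℝ} (hδ : 0 ≤ δ) (h1 : H ≤ algebraMap ℝ A δ)
    (h2 : -H ≤ algebraMap ℝ A δ) : ‖H‖ ≤ δ := by
  have h3 : algebraMap ℝ A (-δ) ≤ H := by rw [map_neg]; exact neg_le.1 h2
  rw [le_algebraMap_iff_spectrum_le] at h1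
  rw [algebraMap_le_iff_le_spectrum] at h3
  have := norm_cfc_le (f := fun x : ℝ => x) (a := H) hδ fun x hx => by
    rw [Real.norm_eq_abs]; exact abs_le.2 ⟨h3 x hx, h1 x hx⟩
  rwa [cfc_id' ℝ H] at this

/-- If the reflected observable `O₀ O₁ O₀` is close to a mixture of `O₁` and a constant outcome,
then it is at least as close to `O₁`. -/
theorem norm_conj_sub_le_of_mixture {A : Type*} [CStarAlgebra A] [PartialOrder A]
    [StarOrderedRing A] {O₀ O₁ : A} (h0 : IsSelfAdjoint O₀) (h1 : IsSelfAdjoint O₁)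
    (h00 : O₀ * O₀ = 1) (h11 : O₁ * O₁ = 1) {p o δ : ℝ} (hp : p ≤ 1) (ho : o = 1 ∨ o = -1)
    (h : ‖O₀ * O₁ * O₀ - (p • O₁ + (1 - p) • (o • (1 : A)))‖ ≤ δ) :
    ‖O₀ * O₁ * O₀ - O₁‖ ≤ δ := by
  set H := O₀ * O₁ * O₀ - O₁ with hHdef
  set F := O₀ * O₁ * O₀ - (p • O₁ + (1 - p) • (o • (1 : A))) with hFdef
  have hδ : 0 ≤ δ := (norm_nonneg _).trans h
  have hconj : IsSelfAdjoint (O₀ * O₁ * O₀) := by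
    rw [IsSelfAdjoint, star_mul, star_mul, h0.star_eq, h1.star_eq, mul_assoc]
  have hH : IsSelfAdjoint H := hconj.sub h1
  have hF : IsSelfAdjoint F := by
    refine hconj.sub (((IsSelfAdjoint.all p).smul h1).add
      ((IsSelfAdjoint.all _).smul ((IsSelfAdjoint.all _).smul (.one A))))
  have hOHO : O₀ * H * O₀ = -H := by
    have : O₀ * (O₀ * O₁ * O₀) * O₀ = O₁ := by
      calc _ = (O₀ * O₀) * O₁ * (O₀ * O₀) := by simp only [mul_assoc]
        _ = O₁ := by rw [h00, one_mul, mul_one]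
    rw [hHdef, mul_sub, sub_mul, this, neg_sub]
  have hmono : algebraMap ℝ A ‖F‖ ≤ algebraMap ℝ A δ := algebraMap_mono A h
  have hconst : O₀ * algebraMap ℝ A δ * O₀ = algebraMap ℝ A δ := by
    rw [← Algebra.commutes, mul_assoc, h00, mul_one]
  -- Such an `x` is `x* x / 2`; this is used for `1 - O₁` and `1 + O₁`.
  have hpos : ∀ x : A, IsSelfAdjoint x → x * x = (2 : ℝ) • x → 0 ≤ x := fun x hx hxx => by
    have h3 : x = (1 / 2 : ℝ) • (star x * x) := by rw [hx.star_eq, hxx, smul_smul]; norm_num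
    rw [h3]
    exact smul_nonneg (by norm_num) (star_mul_self_nonneg x)
  -- The constant outcome decides which side of `H` is bounded directly: `H ≥ F` for `o = 1`, and `H
  -- ≤ F` for `o = -1`. The opposite side comes from conjugating with `O₀`.
  rcases ho with rfl | rfl
  · have hd : 0 ≤ 1 - O₁ := by
      refine hpos _ ((IsSelfAdjoint.one A).sub h1) ?_
      rw [sub_mul, mul_sub, one_mul, mul_sub, h11, two_smul, mul_one, one_mul]; abel
    have hle : -H ≤ -F := by
      have : -F - -H = (1 - p) • (1 - O₁) := by
        rw [hHdef, hFdef, smul_sub, one_smul]; module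
      rw [← sub_nonneg, this]
      exact smul_nonneg (by linarith) hd
    have k1 : -H ≤ algebraMap ℝ A δ := by
      have hF' := hF.neg.le_algebraMap_norm_self
      rw [norm_neg] at hF'
      exact hle.trans (hF'.trans hmono)
    refine norm_le_of_le_of_neg_le hH hδ ?_ k1
    have := star_left_conjugate_le_conjugate k1 O₀
    rwa [h0.star_eq, hconst, mul_neg, neg_mul, hOHO, neg_neg] at this
  · have hd : 0 ≤ 1 + O₁ := by
      refine hpos _ ((IsSelfAdjoint.one A).add h1) ?_
      rw [add_mul, mul_add, one_mul, mul_add, h11, two_smul]; simp [add_comm]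
    have hle : H ≤ F := by
      have : F - H = (1 - p) • (1 + O₁) := by
        rw [hHdef, hFdef, smul_add]; module
      rw [← sub_nonneg, this]
      exact smul_nonneg (by linarith) hd
    have k1 : H ≤ algebraMap ℝ A δ := hle.trans (hF.le_algebraMap_norm_self.trans hmono)
    refine norm_le_of_le_of_neg_le hH hδ k1 ?_
    have := star_left_conjugate_le_conjugate k1 O₀
    rwa [h0.star_eq, hconst, hOHO] at this

theorem norm_le_one_of_reflection {A : Type*} [NormedRing A] [StarRing A] [CStarRing A]
    {O : A} (h : IsSelfAdjoint O) (h1 : O * O = 1) : ‖O‖ ≤ 1 := by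
  have h2 := CStarRing.norm_star_mul_self (x := O)
  rw [h.star_eq, h1] at h2
  have h3 := CStarRing.norm_star_mul_self (x := (1 : A))
  rw [star_one, one_mul] at h3
  nlinarith [norm_nonneg O, norm_nonneg (1 : A), sq_nonneg (‖(1 : A)‖ - 1)]

theorem reflection_of_projection {A : Type*} [Ring A] [StarRing A] {P : A}
    (hP : IsStarProjection P) : IsSelfAdjoint (2 * P - 1) ∧ (2 * P - 1) * (2 * P - 1) = 1 := by
  have h1 := hP.isIdempotentElem.eq
  have h2 := hP.isSelfAdjoint.star_eq
  constructor
  · rw [two_mul, IsSelfAdjoint, star_sub, star_add, h2, star_one]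
  · simp only [two_mul, mul_sub, sub_mul, mul_add, add_mul, h1, mul_one, one_mul]
    abel

/-- The difference factors as `-(P + Q - 1)(PQ - QP)`, and `P + Q - 1` is a contraction, being the
average of the two reflections. -/
theorem norm_sandwich_diff_le {A : Type*} [NormedRing A] [StarRing A] [CStarRing A]
    [NormedAlgebra ℝ A] {P Q : A} (hP : IsStarProjection P) (hQ : IsStarProjection Q) :
    ‖P * Q * P - Q * P * Q‖ ≤ ‖P * Q - Q * P‖ := by
  have e : P * Q * P - Q * P * Q = -((P + Q - 1) * (P * Q - Q * P)) := by
    have h1 := hP.isIdempotentElem.eq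
    have h2 := hQ.isIdempotentElem.eq
    simp only [add_mul, sub_mul, mul_sub, ← mul_assoc, h1, h2, one_mul]
    abel
  have hB : ‖P + Q - 1‖ ≤ 1 := by
    have : P + Q - 1 = (1 / 2 : ℝ) • ((2 * P - 1) + (2 * Q - 1)) := by
      rw [two_mul, two_mul]; module
    rw [this, norm_smul]
    have hp := reflection_of_projection hP
    have hq := reflection_of_projection hQ
    have h1 := norm_le_one_of_reflection hp.1 hp.2
    have h2 := norm_le_one_of_reflection hq.1 hq.2
    have h3 := norm_add_le (2 * P - 1) (2 * Q - 1)
    norm_num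
    linarith
  rw [e, norm_neg]
  exact (norm_mul_le _ _).trans (mul_le_of_le_one_left (norm_nonneg _) hB)

/-- Multiplying the right-hand operator by the reflection of `P` produces the commutator of the
reflections, which is four times that of the projections. -/
theorem four_mul_norm_commutator_le {A : Type*} [NormedRing A] [StarRing A] [CStarRing A]
    [NormedAlgebra ℝ A] {P Q : A} (hP : IsStarProjection P) :
    4 * ‖P * Q - Q * P‖ ≤ ‖(2 * P - 1) * (2 * Q - 1) * (2 * P - 1) - (2 * Q - 1)‖ := by
  have hp := reflection_of_projection hP
  have h1 := norm_le_one_of_reflection hp.1 hp.2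
  have e : (4 : ℝ) • (P * Q - Q * P) =
      ((2 * P - 1) * (2 * Q - 1) * (2 * P - 1) - (2 * Q - 1)) * (2 * P - 1) := by
    have : (2 * P - 1) * (2 * Q - 1) * (2 * P - 1) * (2 * P - 1) = (2 * P - 1) * (2 * Q - 1) := by
      rw [mul_assoc, hp.2, mul_one]
    rw [sub_mul, this]
    simp only [two_mul, mul_sub, sub_mul, mul_add, add_mul, mul_one, one_mul]
    module
  have h2 := norm_mul_le ((2 * P - 1) * (2 * Q - 1) * (2 * P - 1) - (2 * Q - 1)) (2 * P - 1)
  rw [← e, norm_smul] at h2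
  norm_num at h2
  exact h2.trans (mul_le_of_le_one_right (norm_nonneg _) h1)

end SelfAdjoint

/-! ### Submatrices, tensor products, and expectations in states. -/

section MatrixBounds

variable {a b c d : Type} [Fintype a] [DecidableEq a] [Fintype b] [DecidableEq b]
  [Fintype c] [DecidableEq c] [Fintype d] [DecidableEq d]

theorem basisMap_conjTranspose_mul_self {f : a → b} (hf : Function.Injective f) :
    (basisMap f)ᴴ * basisMap f = 1 := by
  ext x y
  simp only [mul_apply, conjTranspose_apply, basisMap, of_apply, one_apply, apply_ite star,
    star_one, star_zero, ite_mul, one_mul, zero_mul, Finset.sum_ite_eq', Finset.mem_univ, if_true,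
    hf.eq_iff]

theorem submatrix_eq_basisMap (A : Matrix b d ℂ) (f : a → b) (g : c → d) :
    A.submatrix f g = (basisMap f)ᴴ * A * basisMap g := by
  ext x y
  simp only [mul_apply, conjTranspose_apply, basisMap, of_apply, apply_ite star, submatrix_apply,
    star_one, star_zero, ite_mul, one_mul, zero_mul, Finset.sum_ite_eq', Finset.mem_univ, if_true,
    mul_ite, mul_one, mul_zero]

theorem norm_submatrix_le (A : Matrix b d ℂ) {f : a → b} {g : c → d}
    (hf : Function.Injective f) (hg : Function.Injective g) : ‖A.submatrix f g‖ ≤ ‖A‖ := by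
  rw [submatrix_eq_basisMap]
  have h1 := norm_le_one_of_isometry (basisMap_conjTranspose_mul_self hf)
  have h2 := norm_le_one_of_isometry (basisMap_conjTranspose_mul_self hg)
  calc _ ≤ ‖(basisMap f)ᴴ‖ * ‖A‖ * ‖basisMap g‖ :=
        (l2_opNorm_mul _ _).trans (by gcongr; exact l2_opNorm_mul _ _)
    _ ≤ 1 * ‖A‖ * 1 := by rw [l2_opNorm_conjTranspose]; gcongr
    _ = ‖A‖ := by ring

theorem norm_kronecker_le (A : Matrix a a ℂ) (B : Matrix b b ℂ) :
    ‖kroneckerMap (· * ·) A B‖ ≤ ‖A‖ * ‖B‖ := by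
  have h1 : kroneckerMap (· * ·) A B =
      kroneckerMap (· * ·) A (1 : Matrix b b ℂ) * kroneckerMap (· * ·) (1 : Matrix a a ℂ) B := by
    rw [← mul_kronecker_mul, Matrix.mul_one, Matrix.one_mul]
  have h2 : kroneckerMap (· * ·) (1 : Matrix a a ℂ) B =
      (kroneckerMap (· * ·) B (1 : Matrix a a ℂ)).submatrix Prod.swap Prod.swap := by
    ext x y
    rw [kroneckerMap_apply, submatrix_apply, kroneckerMap_apply, mul_comm]
    rfl
  rw [h1]
  refine (l2_opNorm_mul _ _).trans ?_
  gcongr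
  · exact norm_kronecker_one_le A
  · rw [h2]
    exact (norm_submatrix_le _ Prod.swap_injective Prod.swap_injective).trans
      (norm_kronecker_one_le B)

theorem trace_eq_sum_inner_eigenvectorBasis (A : Matrix a a ℂ)
    (b : OrthonormalBasis a ℂ (EuclideanSpace ℂ a)) :
    A.trace = ∑ i, inner ℂ (b i) (toEuclideanCLM (𝕜 := ℂ) A (b i)) := by
  refine Eq.trans ?_ (LinearMap.trace_eq_sum_inner (toEuclideanLin (𝕜 := ℂ) A) b)
  rw [toEuclideanLin_eq_toLin_orthonormal, LinearMap.trace_eq_matrix_trace ℂ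
    (EuclideanSpace.basisFun a ℂ).toBasis, LinearMap.toMatrix_toLin]

theorem norm_trace_mul_posSemidef_le (Z : Matrix a a ℂ) {ρ : Matrix a a ℂ} (hρ : ρ.PosSemidef)
    (htr : ρ.trace = 1) : ‖(Z * ρ).trace‖ ≤ ‖Z‖ := by
  have hH := hρ.isHermitian
  have hsum : ∑ i, hH.eigenvalues i = 1 := by
    have := hH.trace_eq_sum_eigenvalues
    rw [htr] at this
    apply Complex.ofReal_injective
    rw [Complex.ofReal_sum, Complex.ofReal_one]
    exact this.symm
  rw [trace_eq_sum_inner_eigenvectorBasis _ hH.eigenvectorBasis]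
  calc _ ≤ ∑ i, ‖Z‖ * hH.eigenvalues i := by
        refine (norm_sum_le _ _).trans (Finset.sum_le_sum fun i _ => ?_)
        have hev : toEuclideanCLM (𝕜 := ℂ) ρ (hH.eigenvectorBasis i) =
            (hH.eigenvalues i : ℂ) • hH.eigenvectorBasis i := by
          apply (WithLp.ofLp_injective 2)
          simp only [ofLp_toEuclideanCLM, WithLp.ofLp_smul]
          exact hH.mulVec_eigenvectorBasis i
        rw [map_mul, mul_apply_eq_comp, hev, map_smul, inner_smul_right, norm_mul,
          Complex.norm_real, Real.norm_of_nonneg (hρ.eigenvalues_nonneg i), mul_comm]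
        refine mul_le_mul_of_nonneg_right ?_ (hρ.eigenvalues_nonneg i)
        refine (norm_inner_le_norm _ _).trans ?_
        rw [hH.eigenvectorBasis.orthonormal.1 i, one_mul]
        refine ((toEuclideanCLM (𝕜 := ℂ) Z).le_opNorm _).trans ?_
        rw [hH.eigenvectorBasis.orthonormal.1 i, mul_one]
        rfl
    _ = ‖Z‖ := by rw [← Finset.mul_sum, hsum, mul_one]

/-- The trace norm of a classical-quantum operator with the blocks `tr₁ ((D i ⊗ 1) ρ)`. -/
theorem traceNorm_diagonal_blocks_le (D : c → Matrix a a ℂ) {ρ : Matrix (a × b) (a × b) ℂ}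
    (hρ : ρ.PosSemidef) (htr : ρ.trace = 1) :
    traceNorm (Matrix.of fun i j : c × b => if i.1 = j.1 then
      (D i.1 * Matrix.of fun x y => ρ (x, i.2) (y, j.2)).trace else 0) ≤ ∑ i, ‖D i‖ := by
  refine traceNorm_le_of_forall fun U hU => ?_
  -- Only the diagonal blocks `Uᵢᵢ` of the test operator meet a classical-quantum operator, and
  -- pairing `Uᵢᵢ` with block `i` is the expectation of `D i ⊗ Uᵢᵢ` in `ρ`. So the reference system
  -- costs nothing.
  have key : (U * Matrix.of fun i j : c × b => if i.1 = j.1 then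
      (D i.1 * Matrix.of fun x y => ρ (x, i.2) (y, j.2)).trace else 0).trace =
      ∑ i, (kroneckerMap (· * ·) (D i)
        (U.submatrix (fun r : b => (i, r)) fun r => (i, r)) * ρ).trace := by
    simp only [trace, diag_apply, mul_apply, of_apply, kroneckerMap_apply, submatrix_apply,
      Fintype.sum_prod_type, mul_ite, mul_zero]
    refine Finset.sum_congr rfl fun i _ => ?_
    calc _ = ∑ r, ∑ s, U (i, r) (i, s) * ∑ x, ∑ y, D i x y * ρ (y, s) (x, r) := by
          refine Finset.sum_congr rfl fun r _ => ?_
          rw [Finset.sum_comm]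
          refine Finset.sum_congr rfl fun s _ => ?_
          simp
      _ = ∑ r, ∑ s, ∑ x, ∑ y, D i x y * U (i, r) (i, s) * ρ (y, s) (x, r) := by
          simp only [Finset.mul_sum]
          refine Finset.sum_congr rfl fun r _ => Finset.sum_congr rfl fun s _ =>
            Finset.sum_congr rfl fun x _ => Finset.sum_congr rfl fun y _ => by ring
      _ = ∑ r, ∑ x, ∑ y, ∑ s, D i x y * U (i, r) (i, s) * ρ (y, s) (x, r) := by
          refine Finset.sum_congr rfl fun r _ => ?_
          rw [Finset.sum_comm]
          refine Finset.sum_congr rfl fun x _ => ?_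
          rw [Finset.sum_comm]
      _ = _ := by rw [Finset.sum_comm]
  rw [key]
  refine (norm_sum_le _ _).trans (Finset.sum_le_sum fun i _ => ?_)
  refine (norm_trace_mul_posSemidef_le _ hρ htr).trans ((norm_kronecker_le _ _).trans ?_)
  refine mul_le_of_le_one_right (norm_nonneg _) ((norm_submatrix_le _ ?_ ?_).trans hU) <;>
  · intro x y h; simpa using h

end MatrixBounds

/-! ### The two orders of measurement. -/

section Measurements

variable {a b : Type} [Fintype a] [DecidableEq a] [Fintype b] [DecidableEq b]

theorem measureThen_apply (P Q X : Matrix a a ℂ) (i j : Bool × Bool) :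
    measureThen P Q X i j = if i = j then
      (outcomeProj Q i.1 * (outcomeProj P i.2 * X * outcomeProj P i.2)).trace else 0 := by
  obtain ⟨q, p⟩ := i
  obtain ⟨q', p'⟩ := j
  simp only [measureThen, LinearMap.comp_apply, ampliate, instrument, outcomeMap,
    LinearMap.coe_mk, AddHom.coe_mk, of_apply, diagonal_apply, Prod.mk.injEq]
  by_cases hq : q = q'
  · by_cases hp : p = p'
    · subst hq; subst hp; simp only [and_self, if_true]; rfl
    · simp only [hq, hp, and_false, if_false, if_true]
      exact (congrArg trace (Matrix.mul_zero _)).trans (trace_zero _ _)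
  · simp [hq]

theorem swapRegisters_apply (X : Matrix (Bool × Bool) (Bool × Bool) ℂ) (i j : Bool × Bool) :
    swapRegisters X i j = X i.swap j.swap := rfl

theorem outcomeProj_isStarProjection {P : Matrix a a ℂ} (hP : IsStarProjection P) (r : Bool) :
    IsStarProjection (outcomeProj P r) := by
  cases r
  · exact hP.one_sub
  · exact hP

/-- Passing to a complementary projector only changes the sign of the commutator, so all four
outcome pairs obey the same bound. -/
theorem norm_outcomeProj_commutator (P Q : Matrix a a ℂ) (r s : Bool) :
    ‖outcomeProj P r * outcomeProj Q s - outcomeProj Q s * outcomeProj P r‖ = ‖P * Q - Q * P‖ := by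
  cases r <;> cases s <;>
    simp only [outcomeProj, if_true, Bool.false_eq_true, if_false, mul_sub, sub_mul, mul_one,
      one_mul]
  · congr 1; abel
  · rw [← norm_neg]; congr 1; abel
  · rw [← norm_neg]; congr 1; abel

/-- The isometry `V` embeds the message space as an invariant subspace of both projectors, so
everything can be computed with `P'` and `Q'`. The joint outcome register is classical, and each of
its four values contributes one commutator. -/
theorem traceNorm_measure_orders_le {P Q : Matrix a a ℂ} {V : Matrix a b ℂ}
    {P' Q' : Matrix b b ℂ} (hV : Vᴴ * V = 1) (hP : P * V = V * P') (hQ : Q * V = V * Q')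
    (hP' : IsStarProjection P') (hQ' : IsStarProjection Q') {r : Type} [Fintype r] [DecidableEq r]
    {ρ : Matrix (b × r) (b × r) ℂ} (hρ : ρ.PosSemidef) (htr : ρ.trace = 1) :
    traceNorm (ampliate r (zeroThenOne P Q ∘ₗ conjMap V) ρ -
      ampliate r (oneThenZero P Q ∘ₗ conjMap V) ρ) ≤ 4 * ‖P' * Q' - Q' * P'‖ := by
  have hproj : ∀ (R : Matrix a a ℂ) (R' : Matrix b b ℂ), R * V = V * R' → ∀ s,
      outcomeProj R s * V = V * outcomeProj R' s := by
    intro R R' h s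
    cases s <;> simp [outcomeProj, Matrix.sub_mul, Matrix.mul_sub, h]
  have hsand : ∀ (R S : Matrix a a ℂ) (R' S' : Matrix b b ℂ), R * V = V * R' → S * V = V * S' →
      ∀ X : Matrix b b ℂ, (S * (R * (V * X * Vᴴ) * R)).trace = (R' * S' * R' * X).trace := by
    intro R S R' S' hR hS X
    calc _ = (Vᴴ * (R * (S * (R * V))) * X).trace := by
          rw [show S * (R * (V * X * Vᴴ) * R) = (S * R * V * X) * (Vᴴ * R) by
            simp only [Matrix.mul_assoc], trace_mul_comm]
          simp only [Matrix.mul_assoc]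
      _ = _ := by
          rw [hR, ← Matrix.mul_assoc S, hS, ← Matrix.mul_assoc R, ← Matrix.mul_assoc R, hR]
          simp only [← Matrix.mul_assoc, hV, Matrix.one_mul]
  let D : Bool × Bool → Matrix b b ℂ := fun i =>
    outcomeProj P' i.1 * outcomeProj Q' i.2 * outcomeProj P' i.1 -
      outcomeProj Q' i.2 * outcomeProj P' i.1 * outcomeProj Q' i.2
  have key : ampliate r (zeroThenOne P Q ∘ₗ conjMap V) ρ -
      ampliate r (oneThenZero P Q ∘ₗ conjMap V) ρ =
      Matrix.of fun i j : (Bool × Bool) × r => if i.1 = j.1 then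
        (D i.1 * Matrix.of fun x y => ρ (x, i.2) (y, j.2)).trace else 0 := by
    ext ⟨⟨p, q⟩, x⟩ ⟨⟨p', q'⟩, y⟩
    simp only [ampliate, LinearMap.coe_mk, AddHom.coe_mk, Matrix.sub_apply, of_apply,
      LinearMap.comp_apply, zeroThenOne, oneThenZero, swapRegisters_apply,
      measureThen_apply, conjMap, Prod.swap_prod_mk, Prod.mk.injEq, and_comm (a := q = q')]
    by_cases h : p = p' ∧ q = q'
    · simp only [h, and_self, if_true]
      rw [hsand _ _ _ _ (hproj P P' hP p') (hproj Q Q' hQ q'),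
        hsand _ _ _ _ (hproj Q Q' hQ q') (hproj P P' hP p'), ← trace_sub, ← Matrix.sub_mul]
    · simp only [h, if_false, sub_zero]
  rw [key]
  refine (traceNorm_diagonal_blocks_le D hρ htr).trans ?_
  calc ∑ i, ‖D i‖ ≤ ∑ _i : Bool × Bool, ‖P' * Q' - Q' * P'‖ := by
        refine Finset.sum_le_sum fun i _ => ?_
        rw [← norm_outcomeProj_commutator P' Q' i.1 i.2]
        exact norm_sandwich_diff_le (outcomeProj_isStarProjection hP' _)
          (outcomeProj_isStarProjection hQ' _)
    _ = _ := by simp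

end Measurements

/-! ### Operators on selected wires, ancillas, and partial traces. -/

section Lift

variable {k l N : ℕ}

/-- The operator `A` on the wires `f 0, f 1, …`, tensored with the identity on the other wires. -/
def liftOp (f : Fin k → Fin N) (A : Matrix (Bits k) (Bits k) ℂ) : Matrix (Bits N) (Bits N) ℂ :=
  Matrix.of fun x y => if ∀ i, (∀ j, f j ≠ i) → x i = y i then A (x ∘ f) (y ∘ f) else 0

/-- The bits on the wires `f 0, f 1, …` and the bits on the other wires. -/
def splitBits (f : Fin k → Fin N) (x : Bits N) : Bits k × ({i // ∀ j, f j ≠ i} → Bool) :=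
  (x ∘ f, fun i => x i.1)

theorem splitBits_bijective {f : Fin k → Fin N} (hf : Function.Injective f) :
    Function.Bijective (splitBits f) := by
  constructor
  · intro x y h
    have h1 := congrArg Prod.fst h
    have h2 := congrArg Prod.snd h
    funext i
    by_cases hi : ∀ j, f j ≠ i
    · exact congrFun h2 ⟨i, hi⟩
    · push Not at hi
      obtain ⟨j, rfl⟩ := hi
      exact congrFun h1 j
  · rintro ⟨u, v⟩
    refine ⟨fun i => if h : ∀ j, f j ≠ i then v ⟨i, h⟩ else
      u (Classical.choose (not_forall_not.1 h)), ?_⟩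
    refine Prod.ext (funext fun j => ?_) (funext fun i => ?_)
    · have h : ¬ ∀ j', f j' ≠ f j := fun h => h j rfl
      simp only [splitBits, Function.comp_apply, dif_neg h]
      exact congrArg u (hf (Classical.choose_spec (not_forall_not.1 h)))
    · simp only [splitBits, dif_pos i.2]

/-- After splitting the bits into selected and remaining ones, the operator is `A ⊗ 1`; algebraic
rules and norm bounds are inherited from the tensor product. -/
theorem liftOp_eq_submatrix (f : Fin k → Fin N) (A : Matrix (Bits k) (Bits k) ℂ) :
    liftOp f A = (kroneckerMap (· * ·) A 1).submatrix (splitBits f) (splitBits f) := by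
  ext x y
  simp only [liftOp, of_apply, submatrix_apply, kroneckerMap_apply, splitBits, one_apply,
    funext_iff, Subtype.forall, mul_ite, mul_one, mul_zero]

theorem liftOp_mul {f : Fin k → Fin N} (hf : Function.Injective f)
    (A B : Matrix (Bits k) (Bits k) ℂ) : liftOp f (A * B) = liftOp f A * liftOp f B := by
  rw [liftOp_eq_submatrix, liftOp_eq_submatrix, liftOp_eq_submatrix,
    ← submatrix_mul _ _ _ _ _ (splitBits_bijective hf), ← mul_kronecker_mul, Matrix.one_mul]

theorem liftOp_conjTranspose (f : Fin k → Fin N) (A : Matrix (Bits k) (Bits k) ℂ) :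
    (liftOp f A)ᴴ = liftOp f Aᴴ := by
  rw [liftOp_eq_submatrix, liftOp_eq_submatrix, conjTranspose_submatrix, conjTranspose_kronecker,
    conjTranspose_one]

theorem liftOp_diagonal (f : Fin k → Fin N) (d : Bits k → ℂ) :
    liftOp f (diagonal d) = diagonal fun x => d (x ∘ f) := by
  ext x y
  simp only [liftOp, of_apply, diagonal_apply]
  by_cases h : x = y
  · simp [h]
  · rw [if_neg h]
    split_ifs with h1 h2
    · refine absurd (funext fun i => ?_) h
      by_cases hi : ∀ j, f j ≠ i
      · exact h1 i hi
      · push Not at hi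
        obtain ⟨j, rfl⟩ := hi
        exact congrFun h2 j
    · rfl
    · rfl

theorem liftOp_one (f : Fin k → Fin N) : liftOp f 1 = 1 := by
  rw [← diagonal_one, liftOp_diagonal, diagonal_one]

theorem liftOp_add (f : Fin k → Fin N) (A B : Matrix (Bits k) (Bits k) ℂ) :
    liftOp f (A + B) = liftOp f A + liftOp f B := by
  ext x y
  simp only [liftOp, of_apply, Matrix.add_apply]
  split_ifs
  · rfl
  · rw [add_zero]

theorem norm_liftOp_le {f : Fin k → Fin N} (hf : Function.Injective f)
    (A : Matrix (Bits k) (Bits k) ℂ) : ‖liftOp f A‖ ≤ ‖A‖ := by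
  rw [liftOp_eq_submatrix]
  exact (norm_submatrix_le _ (splitBits_bijective hf).1 (splitBits_bijective hf).1).trans
    (norm_kronecker_one_le A)

theorem liftOp_liftOp {f : Fin k → Fin N} (hf : Function.Injective f) (g : Fin l → Fin k)
    (A : Matrix (Bits l) (Bits l) ℂ) : liftOp f (liftOp g A) = liftOp (f ∘ g) A := by
  ext x y
  simp only [liftOp, of_apply, Function.comp_apply, Function.comp_assoc, ← ite_and]
  congr 1
  refine propext ⟨fun ⟨h1, h2⟩ i hi => ?_, fun h => ⟨fun i hi => h i fun j => hi _, fun i hi =>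
    h _ fun j hj => hi j (hf hj)⟩⟩
  by_cases hi' : ∀ j, f j ≠ i
  · exact h1 i hi'
  · push Not at hi'
    obtain ⟨j, rfl⟩ := hi'
    exact h2 j fun j' hj' => hi j' (congrArg f hj')

/-- Extend a bit string by zeros (or truncate it). -/
def zeroExt (n N : ℕ) (x : Bits n) : Bits N := fun i => if h : i.val < n then x ⟨i.val, h⟩ else false

theorem zeroExt_injective {n N : ℕ} (h : n ≤ N) : Function.Injective (zeroExt n N) := by
  intro x y hxy
  funext i
  have := congrFun hxy ⟨i.val, by omega⟩
  simpa [zeroExt] using this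

theorem zeroExt_comp_castLE {n N : ℕ} (h : n ≤ N) (x : Bits n) :
    zeroExt n N x ∘ Fin.castLE h = x := by
  funext i
  simp [zeroExt]

/-- The isometry that appends ancillas in the state `|0⟩`. -/
def ancilla (n N : ℕ) : Matrix (Bits N) (Bits n) ℂ := basisMap (zeroExt n N)

theorem addAncillas_eq (a k : ℕ) : addAncillas a k = ancilla a (a + k) := by
  ext y x
  have : Fin.append x (fun _ => false) = zeroExt a (a + k) x := by
    funext i
    refine Fin.addCases (fun j => ?_) (fun j => ?_) i
    · simp [zeroExt]
    · simp [zeroExt]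
  simp only [addAncillas, ancilla, basisMap, of_apply, this]

theorem ancilla_isometry {n N : ℕ} (h : n ≤ N) : (ancilla n N)ᴴ * ancilla n N = 1 :=
  basisMap_conjTranspose_mul_self (zeroExt_injective h)

theorem mul_basisMap_apply {a b c : Type} [Fintype b] [DecidableEq b] (A : Matrix c b ℂ)
    (f : a → b) (x : c) (y : a) : (A * basisMap f) x y = A x (f y) := by
  simp [mul_apply, basisMap]

theorem basisMap_mul_basisMap {a b c : Type} [Fintype b] [DecidableEq b] [DecidableEq c]
    (g : b → c) (f : a → b) : basisMap g * basisMap f = basisMap (g ∘ f) := by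
  ext x y
  rw [mul_basisMap_apply]
  rfl

theorem ancilla_mul_ancilla {n k N : ℕ} (h : n ≤ k) :
    ancilla k N * ancilla n k = ancilla n N := by
  rw [ancilla, ancilla, basisMap_mul_basisMap, ancilla]
  congr 1
  funext x i
  by_cases hi : i.val < n
  · simp [zeroExt, hi, hi.trans_le h]
  · simp [zeroExt, hi]

/-- An operator on the old wires does not notice fresh ancillas. This is how computations on the
large register of the attack are brought back to the original ones. -/
theorem liftOp_castLE_mul_ancilla {n N : ℕ} (h : n ≤ N) (A : Matrix (Bits n) (Bits n) ℂ) :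
    liftOp (Fin.castLE h) A * ancilla n N = ancilla n N * A := by
  ext x y
  rw [ancilla, mul_basisMap_apply, liftOp, of_apply, zeroExt_comp_castLE]
  have hoff : (∀ i, (∀ j, Fin.castLE h j ≠ i) → x i = zeroExt n N y i) ↔
      x = zeroExt n N (x ∘ Fin.castLE h) := by
    rw [funext_iff]
    refine forall_congr' fun i => ?_
    by_cases hi : i.val < n
    · have h1 : ¬ ∀ j, Fin.castLE h j ≠ i := fun hj => hj ⟨i.val, hi⟩ rfl
      simp only [h1, false_imp_iff, true_iff, zeroExt, hi, dif_pos, Function.comp_apply]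
      rfl
    · have h1 : ∀ j, Fin.castLE h j ≠ i := fun j hj => hi (by rw [← hj]; exact j.2)
      simp [h1, zeroExt, hi]
  simp only [hoff, mul_apply, basisMap, of_apply, ite_mul, one_mul, zero_mul]
  split_ifs with hx
  · rw [Finset.sum_eq_single (x ∘ Fin.castLE h)]
    · rw [if_pos hx]
    · intro z _ hz
      rw [if_neg]
      rintro rfl
      exact hz (zeroExt_comp_castLE h z).symm
    · simp
  · symm
    refine Finset.sum_eq_zero fun z _ => if_neg ?_
    rintro rfl
    exact hx (by rw [zeroExt_comp_castLE])

theorem joinBits_castLE {N b : ℕ} (h : b ≤ N) (x : Bits b) (e : Bits (N - b)) :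
    joinBits N b x e ∘ Fin.castLE h = x := by
  funext i
  simp [joinBits]

theorem joinBits_bijective {N b : ℕ} (h : b ≤ N) :
    Function.Bijective (fun p : Bits b × Bits (N - b) => joinBits N b p.1 p.2) := by
  constructor
  · rintro ⟨x, e⟩ ⟨y, e'⟩ hxy
    simp only at hxy
    refine Prod.ext ?_ (funext fun i => ?_)
    · rw [← joinBits_castLE h x e, hxy, joinBits_castLE]
    · have := congrFun hxy ⟨i.val + b, by omega⟩
      simpa [joinBits] using this
  · intro z
    refine ⟨(z ∘ Fin.castLE h, fun i => z ⟨i.val + b, by omega⟩), ?_⟩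
    funext i
    by_cases hi : i.val < b
    · simp only [joinBits, hi, dif_pos, Function.comp_apply]; rfl
    · simp only [joinBits, hi, dif_neg, not_false_eq_true]
      congr 1
      exact Fin.ext (by simp; omega)

theorem liftOp_castLE_submatrix_joinBits {N b : ℕ} (h : b ≤ N)
    (A : Matrix (Bits b) (Bits b) ℂ) :
    (liftOp (Fin.castLE h) A).submatrix (fun p : Bits b × Bits (N - b) => joinBits N b p.1 p.2)
      (fun p : Bits b × Bits (N - b) => joinBits N b p.1 p.2) = kroneckerMap (· * ·) A 1 := by
  ext ⟨x, e⟩ ⟨y, e'⟩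
  rw [submatrix_apply, liftOp, of_apply, kroneckerMap_apply, joinBits_castLE, joinBits_castLE,
    one_apply, mul_ite, mul_one, mul_zero]
  congr 1
  refine propext ⟨fun hoff => funext fun i => ?_, fun he => ?_⟩
  · have := hoff ⟨i.val + b, by omega⟩ fun j hj => by
      have := congrArg Fin.val hj
      simp only [Fin.val_castLE] at this
      omega
    simpa [joinBits] using this
  · simp only at he
    subst he
    intro i hi
    have : ¬ i.val < b := fun hlt => hi ⟨i.val, hlt⟩ rfl
    simp [joinBits, this]

theorem trace_submatrix_bijective {a b : Type} [Fintype a] [Fintype b] {e : a → b}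
    (he : Function.Bijective e) (X : Matrix b b ℂ) : (X.submatrix e e).trace = X.trace :=
  he.sum_comp fun x => X x x

/-- The partial trace is dual to tensoring with the identity. -/
theorem trace_mul_keepFirst {N b : ℕ} (h : b ≤ N) (A : Matrix (Bits b) (Bits b) ℂ)
    (X : Matrix (Bits N) (Bits N) ℂ) :
    (A * keepFirst N b X).trace = (liftOp (Fin.castLE h) A * X).trace := by
  rw [← trace_submatrix_bijective (joinBits_bijective h), submatrix_mul _ _ _ _ _
    (joinBits_bijective h), liftOp_castLE_submatrix_joinBits]
  simp only [trace, diag_apply, mul_apply, keepFirst, LinearMap.coe_mk, AddHom.coe_mk, of_apply,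
    Finset.mul_sum, Fintype.sum_prod_type, kroneckerMap_apply, submatrix_apply, one_apply, mul_ite,
    mul_one, mul_zero, ite_mul, zero_mul, Finset.sum_ite_eq, Finset.mem_univ, if_true]
  refine Finset.sum_congr rfl fun x _ => ?_
  rw [Finset.sum_comm]

end Lift

/-! ### Relabelled, inverted, and sign-flipping circuits. -/

section Gates

/-- Renumber the wires of a gate. -/
def Gate.relabel (φ : ℕ → ℕ) : Gate → Gate
  | .had i => .had (φ i)
  | .tee i => .tee (φ i)
  | .teeInv i => .teeInv (φ i)
  | .cnot i j => .cnot (φ i) (φ j)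

/-- The inverse of a gate. -/
def Gate.inv : Gate → Gate
  | .had i => .had i
  | .tee i => .teeInv i
  | .teeInv i => .tee i
  | .cnot i j => .cnot i j

theorem Gate.WellFormed.inv {N : ℕ} {g : Gate} (h : g.WellFormed N) : g.inv.WellFormed N := by
  cases g <;> exact h

theorem Gate.WellFormed.relabel {k N : ℕ} {g : Gate} (h : g.WellFormed k) {φ : ℕ → ℕ}
    (hφ : Function.Injective φ) (hN : ∀ i < k, φ i < N) : (g.relabel φ).WellFormed N := by
  cases g with
  | cnot i j => exact ⟨hN i h.1, hN j h.2.1, fun e => h.2.2 (hφ e)⟩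
  | had i => exact hN i h
  | tee i => exact hN i h
  | teeInv i => exact hN i h

theorem Gate.relabel_id (g : Gate) : g.relabel (fun i => i) = g := by
  cases g <;> rfl

theorem Gate.toMatrix_cnot {N : ℕ} {i j : Fin N} (h : i ≠ j) :
    (Gate.cnot i j).toMatrix N =
      basisMap fun y : Bits N => Function.update y j (xor (y j) (y i)) := by
  have hc : i.val < N ∧ j.val < N ∧ i.val ≠ j.val := ⟨i.2, j.2, fun e => h (Fin.ext e)⟩
  simp only [Gate.toMatrix, dif_pos hc]
  rfl

/-- A gate acts as the identity off the wires it names, so renumbering wires injectively only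
transports its matrix. The instrument circuit is moved into the attack in this way. -/
theorem Gate.toMatrix_relabel {k N : ℕ} {f : Fin k → Fin N} (hf : Function.Injective f)
    {φ : ℕ → ℕ} (hφ : ∀ i, (f i).val = φ i.val) {g : Gate} (h : g.WellFormed k) :
    (g.relabel φ).toMatrix N = liftOp f (g.toMatrix k) := by
  have hlt : ∀ i, i < k → φ i < N := fun i hi => by rw [← hφ ⟨i, hi⟩]; exact (f ⟨i, hi⟩).2
  have hfe : ∀ i (hi : i < k), (⟨φ i, hlt i hi⟩ : Fin N) = f ⟨i, hi⟩ := fun i hi =>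
    Fin.ext (hφ ⟨i, hi⟩).symm
  cases g with
  | had i =>
    have hi : i < k := h
    ext x y
    simp only [Gate.relabel, Gate.toMatrix, hi, hlt i hi, dif_pos, liftOp, of_apply, hfe,
      Function.comp_apply, ← ite_and]
    congr 1
    refine propext ⟨fun h1 => ⟨fun j hj => h1 j fun e => hj _ e.symm, fun j hj =>
      h1 _ fun e => hj (hf e)⟩, fun ⟨h1, h2⟩ j hj => ?_⟩
    by_cases hj' : ∀ j', f j' ≠ j
    · exact h1 j hj'
    · push Not at hj'
      obtain ⟨j', rfl⟩ := hj'
      exact h2 j' fun e => hj (by rw [e])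
  | tee i =>
    have hi : i < k := h
    simp only [Gate.relabel, Gate.toMatrix, hi, hlt i hi, dif_pos, liftOp_diagonal, hfe,
      Function.comp_apply]
  | teeInv i =>
    have hi : i < k := h
    simp only [Gate.relabel, Gate.toMatrix, hi, hlt i hi, dif_pos, liftOp_diagonal, hfe,
      Function.comp_apply]
  | cnot i j =>
    obtain ⟨hi, hj, hij⟩ := id h
    have hne : (⟨i, hi⟩ : Fin k) ≠ ⟨j, hj⟩ := fun e => hij (congrArg Fin.val e)
    have e1 := Gate.toMatrix_cnot hne
    have e2 := Gate.toMatrix_cnot (hf.ne hne)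
    rw [hφ, hφ] at e2
    simp only at e1 e2
    ext x y
    rw [Gate.relabel, e1, e2]
    simp only [basisMap, liftOp, of_apply, Function.comp_apply, ← ite_and]
    congr 1
    refine propext ⟨fun h1 => ⟨fun l hl => ?_, funext fun l => ?_⟩, fun ⟨h1, h2⟩ =>
      funext fun l => ?_⟩
    · rw [h1, Function.update_of_ne (hl _).symm]
    · by_cases hl : l = ⟨j, hj⟩
      · subst hl
        rw [Function.comp_apply, h1, Function.update_self, Function.update_self]
      · rw [Function.comp_apply, h1, Function.update_of_ne fun e => hl (hf e),
          Function.update_of_ne hl, Function.comp_apply]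
    · by_cases hl : ∀ l', f l' ≠ l
      · rw [h1 l hl, Function.update_of_ne (hl _).symm]
      · push Not at hl
        obtain ⟨l', rfl⟩ := hl
        have := congrFun h2 l'
        rw [Function.comp_apply] at this
        rw [this]
        by_cases hl : l' = ⟨j, hj⟩
        · subst hl
          rw [Function.update_self, Function.update_self]
        · rw [Function.update_of_ne hl, Function.update_of_ne fun e => hl (hf e),
            Function.comp_apply]

theorem gatesMatrix_foldl (N : ℕ) (gs : List Gate) (U : Matrix (Bits N) (Bits N) ℂ) :
    gs.foldl (fun U g => g.toMatrix N * U) U = gatesMatrix N gs * U := by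
  induction gs generalizing U with
  | nil => simp [gatesMatrix]
  | cons g gs ih =>
    have h := ih (g.toMatrix N * 1)
    rw [List.foldl_cons, ih]
    conv_rhs => rw [gatesMatrix, List.foldl_cons, h]
    rw [Matrix.mul_one, Matrix.mul_assoc]

theorem gatesMatrix_append (N : ℕ) (gs hs : List Gate) :
    gatesMatrix N (gs ++ hs) = gatesMatrix N hs * gatesMatrix N gs := by
  conv_lhs => rw [gatesMatrix]
  rw [List.foldl_append, gatesMatrix_foldl]
  rfl

theorem gatesMatrix_cons (N : ℕ) (g : Gate) (gs : List Gate) :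
    gatesMatrix N (g :: gs) = gatesMatrix N gs * g.toMatrix N := by
  conv_lhs => rw [gatesMatrix]
  rw [List.foldl_cons, gatesMatrix_foldl, Matrix.mul_one]

theorem gatesMatrix_relabel {k N : ℕ} {f : Fin k → Fin N} (hf : Function.Injective f)
    {φ : ℕ → ℕ} (hφ : ∀ i, (f i).val = φ i.val) (gs : List Gate) (h : ∀ g ∈ gs, g.WellFormed k) :
    gatesMatrix N (gs.map (Gate.relabel φ)) = liftOp f (gatesMatrix k gs) := by
  induction gs with
  | nil => simp [gatesMatrix, liftOp_one]
  | cons g gs ih =>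
    rw [List.map_cons, gatesMatrix_cons, gatesMatrix_cons, liftOp_mul hf,
      ih fun g' hg' => h g' (List.mem_cons_of_mem _ hg'),
      Gate.toMatrix_relabel hf hφ (h g List.mem_cons_self)]

theorem Gate.toMatrix_inv (N : ℕ) (g : Gate) : g.inv.toMatrix N = (g.toMatrix N)ᴴ := by
  have h4 : (starRingEnd ℂ) 4 = 4 := map_ofNat _ 4
  cases g with
  | had i =>
    by_cases hi : i < N
    · ext x y
      simp only [Gate.inv, Gate.toMatrix, hi, dif_pos, of_apply, conjTranspose_apply,
        eq_comm (a := x _)]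
      split_ifs <;> simp <;> simp_all
    · simp [Gate.inv, Gate.toMatrix, hi]
  | tee i =>
    by_cases hi : i < N
    · simp only [Gate.inv, Gate.toMatrix, hi, dif_pos, diagonal_conjTranspose]
      congr 1
      funext x
      simp only [Pi.star_apply, apply_ite star, star_one, Complex.star_def, ← Complex.exp_conj]
      congr 2
      simp [h4]
      ring
    · simp [Gate.inv, Gate.toMatrix, hi]
  | teeInv i =>
    by_cases hi : i < N
    · simp only [Gate.inv, Gate.toMatrix, hi, dif_pos, diagonal_conjTranspose]
      congr 1
      funext x
      simp only [Pi.star_apply, apply_ite star, star_one, Complex.star_def, ← Complex.exp_conj]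
      congr 2
      simp [h4]
      ring
    · simp [Gate.inv, Gate.toMatrix, hi]
  | cnot i j =>
    by_cases hc : i < N ∧ j < N ∧ i ≠ j
    · ext x y
      simp only [Gate.inv, Gate.toMatrix, dif_pos hc, of_apply, conjTranspose_apply, apply_ite star,
        star_one, star_zero]
      have hne : (⟨i, hc.1⟩ : Fin N) ≠ ⟨j, hc.2.1⟩ := fun e => hc.2.2 (congrArg Fin.val e)
      have key : ∀ x y : Bits N, x = Function.update y ⟨j, hc.2.1⟩
          (xor (y ⟨j, hc.2.1⟩) (y ⟨i, hc.1⟩)) → y = Function.update x ⟨j, hc.2.1⟩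
          (xor (x ⟨j, hc.2.1⟩) (x ⟨i, hc.1⟩)) := by
        rintro x y rfl
        rw [Function.update_self, Function.update_of_ne hne, Function.update_idem]
        simp
      congr 1
      exact propext ⟨key x y, key y x⟩
    · simp [Gate.inv, Gate.toMatrix, hc]

theorem Gate.toMatrix_unitary (N : ℕ) (g : Gate) : (g.toMatrix N)ᴴ * g.toMatrix N = 1 := by
  have h4 : (starRingEnd ℂ) 4 = 4 := map_ofNat _ 4
  cases g with
  | had i =>
    by_cases hi : i < N
    -- A Hadamard gate on any wire is the lift of the one-qubit gate, which leaves a two-by-two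
    -- computation.
    · have h1 : Function.Injective (fun _ : Fin 1 => (⟨i, hi⟩ : Fin N)) :=
        fun a b _ => Subsingleton.elim a b
      have h2 := Gate.toMatrix_relabel h1 (φ := fun _ => i) (fun _ => rfl)
        (g := .had 0) (k := 1) Nat.zero_lt_one
      simp only [Gate.relabel] at h2
      rw [h2, liftOp_conjTranspose, ← liftOp_mul h1]
      convert liftOp_one _
      ext x y
      have hs : (Real.sqrt 2 : ℂ) * (Real.sqrt 2 : ℂ) = 2 := by
        rw [← Complex.ofReal_mul, Real.mul_self_sqrt (by norm_num)]; simp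
      have hs0 : (Real.sqrt 2 : ℂ) ≠ 0 := by simp
      rw [mul_apply, ← (Equiv.funUnique (Fin 1) Bool).symm.sum_comp]
      simp only [Gate.toMatrix, Nat.zero_lt_one, dif_pos, conjTranspose_apply, of_apply]
      simp only [one_apply]
      have hx : ∀ u : Bits 1, u = fun _ => u 0 := fun u => funext fun j => by
        rw [Subsingleton.elim j 0]
      rw [hx x, hx y]
      generalize x 0 = s
      generalize y 0 = t
      have hfe : ((fun _ : Fin 1 => s) = fun _ => t) ↔ s = t :=
        ⟨fun e => congrFun e 0, fun e => by rw [e]⟩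
      simp only [hfe]
      cases s <;> cases t <;> simp <;> field_simp <;>
        simp only [pow_two, hs] <;> norm_num
    · simp [Gate.toMatrix, hi]
  | tee i =>
    by_cases hi : i < N
    · simp only [Gate.toMatrix, hi, dif_pos, diagonal_conjTranspose, diagonal_mul_diagonal,
        ← diagonal_one]
      congr 1
      funext x
      simp only [Pi.star_apply, apply_ite star, star_one, Complex.star_def, ← Complex.exp_conj]
      split_ifs
      · rw [← Complex.exp_add, ← Complex.exp_zero]
        congr 1
        simp [h4]
        ring
      · simp
    · simp [Gate.toMatrix, hi]
  | teeInv i =>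
    by_cases hi : i < N
    · simp only [Gate.toMatrix, hi, dif_pos, diagonal_conjTranspose, diagonal_mul_diagonal,
        ← diagonal_one]
      congr 1
      funext x
      simp only [Pi.star_apply, apply_ite star, star_one, Complex.star_def, ← Complex.exp_conj]
      split_ifs
      · rw [← Complex.exp_add, ← Complex.exp_zero]
        congr 1
        simp [h4]
        ring
      · simp
    · simp [Gate.toMatrix, hi]
  | cnot i j =>
    by_cases hc : i < N ∧ j < N ∧ i ≠ j
    · have hne : (⟨i, hc.1⟩ : Fin N) ≠ ⟨j, hc.2.1⟩ := fun e => hc.2.2 (congrArg Fin.val e)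
      have h1 := Gate.toMatrix_cnot hne
      simp only at h1
      rw [h1]
      refine basisMap_conjTranspose_mul_self (Function.Involutive.injective fun y => ?_)
      simp only [Function.update_self, Function.update_of_ne hne, Function.update_idem]
      simp
    · simp [Gate.toMatrix, hc]

theorem gatesMatrix_unitary (N : ℕ) (gs : List Gate) :
    (gatesMatrix N gs)ᴴ * gatesMatrix N gs = 1 := by
  induction gs with
  | nil => simp [gatesMatrix]
  | cons g gs ih =>
    calc _ = (g.toMatrix N)ᴴ * ((gatesMatrix N gs)ᴴ * gatesMatrix N gs) * g.toMatrix N := by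
          rw [gatesMatrix_cons, conjTranspose_mul]; simp only [Matrix.mul_assoc]
      _ = 1 := by rw [ih, Matrix.mul_one, Gate.toMatrix_unitary]

/-- The inverse circuit. -/
def invGates (gs : List Gate) : List Gate := (gs.map Gate.inv).reverse

theorem gatesMatrix_invGates (N : ℕ) (gs : List Gate) :
    gatesMatrix N (invGates gs) = (gatesMatrix N gs)ᴴ := by
  induction gs with
  | nil => simp [gatesMatrix, invGates]
  | cons g gs ih =>
    rw [invGates, List.map_cons, List.reverse_cons, gatesMatrix_append, gatesMatrix_cons,
      gatesMatrix_cons, conjTranspose_mul, ← Gate.toMatrix_inv, ← ih]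
    simp [gatesMatrix, invGates]

/-- The sign flip of the first wire. -/
def flipGates : List Gate := List.replicate 4 (.tee 0)

/-- Four `T` gates multiply the phase of `|1⟩` by `exp (iπ/4) ^ 4 = -1`. -/
theorem gatesMatrix_flipGates {N : ℕ} (h : 0 < N) :
    gatesMatrix N flipGates = diagonal fun x => if x ⟨0, h⟩ then -1 else 1 := by
  have hexp : Complex.exp (Complex.I * Real.pi / 4) ^ 4 = -1 := by
    rw [← Complex.exp_nat_mul, ← Complex.exp_pi_mul_I]
    congr 1
    push_cast
    ring
  simp only [flipGates, List.replicate, gatesMatrix, List.foldl, Gate.toMatrix, dif_pos h,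
    Matrix.mul_one, diagonal_mul_diagonal]
  congr 1
  funext x
  split_ifs
  · rw [← hexp]; ring
  · simp

end Gates

/-! ### Diamond norm bounds in the Heisenberg picture. -/

section Observables

variable {a b c d : Type} [Fintype a] [DecidableEq a] [Fintype b] [DecidableEq b]
  [Fintype c] [DecidableEq c] [Fintype d] [DecidableEq d]

theorem eq_of_forall_trace {A B : Matrix a a ℂ} (h : ∀ X, (A * X).trace = (B * X).trace) :
    A = B := by
  have : ‖A - B‖ ≤ 0 := norm_le_of_forall_trace fun X _ => by
    rw [Matrix.sub_mul, trace_sub, h, sub_self, norm_zero]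
  exact sub_eq_zero.1 (norm_le_zero_iff.1 this)

/-- A one-dimensional reference system is enough; most of the work is identifying `a × Fin 1` with
`a`. -/
theorem DiamondNormLE.norm_trace_le {Φ : SuperOp a b} {δ : ℝ} (h : DiamondNormLE Φ δ)
    {B : Matrix b b ℂ} (hB : ‖B‖ ≤ 1) {X : Matrix a a ℂ} (hX : traceNorm X ≤ 1) :
    ‖(B * Φ X).trace‖ ≤ δ := by
  have hfst : ∀ t : Type, Function.Bijective (Prod.fst : t × Fin 1 → t) := fun t =>
    (Equiv.prodUnique t (Fin 1)).bijective
  have hX1 : traceNorm (X.submatrix Prod.fst Prod.fst : Matrix (a × Fin 1) (a × Fin 1) ℂ) ≤ 1 := by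
    refine traceNorm_le_of_forall fun U hU => ?_
    have hU' : U = (U.submatrix (fun x => (x, 0)) fun x => (x, 0)).submatrix Prod.fst Prod.fst := by
      ext ⟨x, i⟩ ⟨y, j⟩
      rw [Subsingleton.elim i 0, Subsingleton.elim j 0]
      rfl
    have hinj : Function.Injective fun x : a => (x, (0 : Fin 1)) := fun x y hxy =>
      congrArg Prod.fst hxy
    rw [hU', ← submatrix_mul _ _ _ _ _ (hfst a), trace_submatrix_bijective (hfst a)]
    refine (norm_trace_mul_le _ _).trans ?_
    exact mul_le_one₀ ((norm_submatrix_le U hinj hinj).trans hU) (traceNorm_nonneg X) hX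
  have h2 := h 1 _ hX1
  have h3 : ampliate (Fin 1) Φ (X.submatrix Prod.fst Prod.fst) =
      (Φ X).submatrix Prod.fst Prod.fst := rfl
  rw [h3] at h2
  rw [← trace_submatrix_bijective (hfst b), submatrix_mul _ _ _ _ _ (hfst b)]
  refine (norm_trace_mul_le _ _).trans ?_
  exact (mul_le_of_le_one_left (traceNorm_nonneg _)
    ((norm_submatrix_le B (hfst b).1 (hfst b).1).trans hB)).trans h2

/-- Here `D` is the observable `B` pulled back through `Φ`. Correctness, security and the instrument
guarantee all enter the argument in this form. -/
theorem DiamondNormLE.norm_le {Φ : SuperOp a b} {δ : ℝ} (h : DiamondNormLE Φ δ)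
    {B : Matrix b b ℂ} (hB : ‖B‖ ≤ 1) {D : Matrix a a ℂ}
    (hD : ∀ X, (B * Φ X).trace = (D * X).trace) : ‖D‖ ≤ δ :=
  norm_le_of_forall_trace fun X hX => by rw [← hD]; exact h.norm_trace_le hB hX

/-- The observable that is `1` on the outcome `1` and `-1` on the outcome `0`. -/
def outcomeSign : Matrix Bool Bool ℂ := diagonal fun r => if r then 1 else -1

theorem norm_diagonal_ite_le (p : a → Bool) {s t : ℂ} (hs : ‖s‖ ≤ 1) (ht : ‖t‖ ≤ 1) :
    ‖(diagonal fun x => if p x then s else t)‖ ≤ 1 := by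
  rw [l2_opNorm_diagonal]
  refine (pi_norm_le_iff_of_nonneg zero_le_one).2 fun x => ?_
  split_ifs <;> assumption

theorem trace_outcomeSign_mul_outcomeMap (P X : Matrix a a ℂ) :
    (outcomeSign * outcomeMap P X).trace = ((2 * P - 1) * X).trace := by
  simp only [outcomeSign, outcomeMap, LinearMap.coe_mk, AddHom.coe_mk, diagonal_mul_diagonal,
    trace_diagonal, Fintype.sum_bool, outcomeProj, if_true, Bool.false_eq_true, if_false]
  simp only [two_mul, sub_mul, add_mul, trace_sub, trace_add]
  ring

theorem trace_mul_conjMap (B : Matrix b b ℂ) (V : Matrix b a ℂ) (X : Matrix a a ℂ) :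
    (B * conjMap V X).trace = (Vᴴ * B * V * X).trace := by
  change (B * (V * X * Vᴴ)).trace = _
  rw [← Matrix.mul_assoc, trace_mul_comm]
  simp only [Matrix.mul_assoc]

theorem basisMap_mul_conjTranspose {f : a → b} (hf : Function.Injective f)
    (p : b → Prop) [DecidablePred p] (hp : ∀ y, p y ↔ ∃ x, f x = y) :
    basisMap f * (basisMap f)ᴴ = diagonal fun y => if p y then 1 else 0 := by
  ext y z
  simp only [mul_apply, conjTranspose_apply, basisMap, of_apply, diagonal_apply, apply_ite star,
    star_one, star_zero, ite_mul, one_mul, zero_mul, hp]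
  by_cases h : ∃ x, f x = y
  · obtain ⟨x, rfl⟩ := h
    have h' : ∃ x', f x' = f x := ⟨x, rfl⟩
    rw [if_pos h', Finset.sum_eq_single x]
    · simp [eq_comm]
    · intro x' _ hx'
      rw [if_neg fun e => hx' (hf e).symm]
    · simp
  · rw [if_neg h, ite_self]
    refine Finset.sum_eq_zero fun x _ => if_neg fun e => h ⟨x, e.symm⟩

/-- The operator `A ⊗ 1`. -/
def tensorOne (e : Type) [DecidableEq e] (A : Matrix a b ℂ) : Matrix (a × e) (b × e) ℂ :=
  kroneckerMap (· * ·) A 1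

theorem tensorOne_mul (e : Type) [Fintype e] [DecidableEq e] (A : Matrix a b ℂ)
    (B : Matrix b c ℂ) : tensorOne e (A * B) = tensorOne e A * tensorOne e B := by
  rw [tensorOne, tensorOne, tensorOne, ← mul_kronecker_mul, Matrix.one_mul]

theorem tensorOne_conjTranspose (e : Type) [DecidableEq e] (A : Matrix a b ℂ) :
    (tensorOne e A)ᴴ = tensorOne e Aᴴ := by
  rw [tensorOne, tensorOne, conjTranspose_kronecker, conjTranspose_one]

theorem tensorOne_one (e : Type) [DecidableEq e] : tensorOne e (1 : Matrix a a ℂ) = 1 :=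
  one_kronecker_one

theorem tensorOne_add (e : Type) [DecidableEq e] (A B : Matrix a b ℂ) :
    tensorOne e (A + B) = tensorOne e A + tensorOne e B :=
  add_kronecker A B 1

theorem norm_tensorOne_le (e : Type) [Fintype e] [DecidableEq e] (A : Matrix a b ℂ) :
    ‖tensorOne e A‖ ≤ ‖A‖ :=
  norm_kronecker_one_le A

end Observables

/-! ### Isometries of circuits and the encoding of `H_M ⊕ ⊥`. -/

section Circuits

/-- The isometry of a circuit: append the ancillas and apply the gates. -/
noncomputable def Circuit.isometry (c : Circuit) (a : ℕ) :
    Matrix (Bits (a + c.ancillas)) (Bits a) ℂ :=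
  gatesMatrix (a + c.ancillas) c.gates * ancilla a (a + c.ancillas)

theorem Circuit.isometry_conjTranspose_mul_self (c : Circuit) (a : ℕ) :
    (c.isometry a)ᴴ * c.isometry a = 1 := by
  rw [Circuit.isometry, conjTranspose_mul, Matrix.mul_assoc, ← Matrix.mul_assoc _ _ (ancilla _ _),
    gatesMatrix_unitary, Matrix.one_mul, ancilla_isometry (Nat.le_add_right _ _)]

theorem Circuit.trace_mul_channel (C : Circuit) {a b : ℕ} (h : b ≤ a + C.ancillas)
    (B : Matrix (Bits b) (Bits b) ℂ) (X : Matrix (Bits a) (Bits a) ℂ) :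
    (B * C.channel a b X).trace =
      ((C.isometry a)ᴴ * liftOp (Fin.castLE h) B * C.isometry a * X).trace := by
  rw [Circuit.channel, LinearMap.comp_apply, trace_mul_keepFirst h, trace_mul_conjMap,
    addAncillas_eq, Circuit.isometry]

/-- The isometry of a circuit, with the output register and the register that is traced out
separated. -/
noncomputable def Circuit.dilation (c : Circuit) (a b : ℕ) :
    Matrix (Bits b × Bits (a + c.ancillas - b)) (Bits a) ℂ :=
  (c.isometry a).submatrix (fun p => joinBits (a + c.ancillas) b p.1 p.2) id

theorem Circuit.dilation_conjTranspose_mul_self (C : Circuit) {a b : ℕ}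
    (h : b ≤ a + C.ancillas) : (C.dilation a b)ᴴ * C.dilation a b = 1 := by
  rw [Circuit.dilation, conjTranspose_submatrix, ← submatrix_mul _ _ _ _ _ (joinBits_bijective h),
    C.isometry_conjTranspose_mul_self, submatrix_id_id]

theorem Circuit.trace_mul_channel_dilation (C : Circuit) {a b : ℕ} (h : b ≤ a + C.ancillas)
    (B : Matrix (Bits b) (Bits b) ℂ) (X : Matrix (Bits a) (Bits a) ℂ) :
    (B * C.channel a b X).trace =
      ((C.dilation a b)ᴴ * tensorOne (Bits (a + C.ancillas - b)) B * C.dilation a b * X).trace := by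
  rw [C.trace_mul_channel h, tensorOne, ← liftOp_castLE_submatrix_joinBits h, Circuit.dilation,
    conjTranspose_submatrix, ← submatrix_mul _ _ _ _ _ (joinBits_bijective h),
    ← submatrix_mul _ _ _ _ _ (joinBits_bijective h), submatrix_id_id]

theorem encodeRej_injective (m : ℕ) : Function.Injective (encodeRej m) := by
  rintro (_ | x) (_ | y) h
  · rfl
  · exact absurd (congrFun h 0) (by simp [encodeRej])
  · exact absurd (congrFun h 0) (by simp [encodeRej])
  · exact congrArg some (Fin.cons_injective2 h).2

/-- The isometry from `H_M ⊕ ⊥` to `m + 1` qubits. -/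
def encodeMatrix (m : ℕ) : Matrix (Bits (m + 1)) (Rej m) ℂ := basisMap (encodeRej m)

theorem encodeMatrix_isometry (m : ℕ) : (encodeMatrix m)ᴴ * encodeMatrix m = 1 :=
  basisMap_conjTranspose_mul_self (encodeRej_injective m)

/-- An operator on `H_M ⊕ ⊥` as an operator on `m + 1` qubits. -/
def encodeOp {m : ℕ} (B : Matrix (Rej m) (Rej m) ℂ) : Matrix (Bits (m + 1)) (Bits (m + 1)) ℂ :=
  encodeMatrix m * B * (encodeMatrix m)ᴴ

theorem encodeOp_mul {m : ℕ} (A B : Matrix (Rej m) (Rej m) ℂ) :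
    encodeOp A * encodeOp B = encodeOp (A * B) := by
  calc _ = encodeMatrix m * A * ((encodeMatrix m)ᴴ * encodeMatrix m) * B * (encodeMatrix m)ᴴ := by
        simp only [encodeOp, Matrix.mul_assoc]
    _ = _ := by
        rw [encodeMatrix_isometry]; simp only [encodeOp, Matrix.mul_assoc, Matrix.one_mul]

theorem encodeOp_conjTranspose {m : ℕ} (A : Matrix (Rej m) (Rej m) ℂ) :
    (encodeOp A)ᴴ = encodeOp Aᴴ := by
  simp only [encodeOp, conjTranspose_mul, conjTranspose_conjTranspose, Matrix.mul_assoc]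

theorem norm_encodeOp_le {m : ℕ} (A : Matrix (Rej m) (Rej m) ℂ) : ‖encodeOp A‖ ≤ ‖A‖ := by
  have h := norm_le_one_of_isometry (encodeMatrix_isometry m)
  calc _ ≤ ‖encodeMatrix m‖ * ‖A‖ * ‖(encodeMatrix m)ᴴ‖ :=
        (l2_opNorm_mul _ _).trans (by gcongr; exact l2_opNorm_mul _ _)
    _ ≤ 1 * ‖A‖ * 1 := by rw [l2_opNorm_conjTranspose]; gcongr
    _ = ‖A‖ := by ring

variable {m c : ℕ} {C : Circuit} {Ver : SuperOp (Bits c) (Rej m)}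

theorem trace_mul_of_encoded (h : m + 1 ≤ c + C.ancillas)
    (hC : C.channel c (m + 1) = conjMap (encodeMatrix m) ∘ₗ Ver) (B : Matrix (Rej m) (Rej m) ℂ)
    (Y : Matrix (Bits c) (Bits c) ℂ) : (B * Ver Y).trace =
      ((C.isometry c)ᴴ * liftOp (Fin.castLE h) (encodeOp B) * C.isometry c * Y).trace := by
  rw [← C.trace_mul_channel h, hC, LinearMap.comp_apply, trace_mul_conjMap]
  congr 2
  calc B = ((encodeMatrix m)ᴴ * encodeMatrix m) * B * ((encodeMatrix m)ᴴ * encodeMatrix m) := by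
        rw [encodeMatrix_isometry, Matrix.one_mul, Matrix.mul_one]
    _ = _ := by simp only [encodeOp, Matrix.mul_assoc]

/-- `encodeOp 1` is the projector onto the code space of `H_M ⊕ ⊥`. Verification always outputs a
state in that space, so the projector has expectation `1` on the range of the isometry and therefore
fixes it. -/
theorem liftOp_encodeOp_one_mul_isometry (h : m + 1 ≤ c + C.ancillas)
    (hC : C.channel c (m + 1) = conjMap (encodeMatrix m) ∘ₗ Ver) :
    liftOp (Fin.castLE h) (encodeOp 1) * C.isometry c = C.isometry c := by
  set R := liftOp (Fin.castLE h) (encodeOp (1 : Matrix (Rej m) (Rej m) ℂ)) with hR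
  have hinj : Function.Injective (Fin.castLE h) := Fin.castLE_injective h
  have h1 : (C.isometry c)ᴴ * R * C.isometry c = 1 := by
    refine eq_of_forall_trace fun Y => ?_
    rw [← trace_mul_of_encoded h hC, Matrix.one_mul, Matrix.one_mul]
    have h2 := C.trace_mul_channel h 1 Y
    rw [liftOp_one, Matrix.mul_one, C.isometry_conjTranspose_mul_self, hC, LinearMap.comp_apply,
      trace_mul_conjMap, Matrix.mul_one, encodeMatrix_isometry, Matrix.one_mul, Matrix.one_mul]
      at h2
    exact h2
  have hs : Rᴴ = R := by
    rw [hR, liftOp_conjTranspose, encodeOp_conjTranspose, conjTranspose_one]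
  have hp : R * R = R := by
    rw [hR, ← liftOp_mul hinj, encodeOp_mul, Matrix.one_mul]
  have h0 : (R * C.isometry c - C.isometry c)ᴴ * (R * C.isometry c - C.isometry c) = 0 := by
    have e : (C.isometry c)ᴴ * R * (R * C.isometry c) = 1 := by
      rw [Matrix.mul_assoc, ← Matrix.mul_assoc R, hp, ← Matrix.mul_assoc, h1]
    rw [conjTranspose_sub, conjTranspose_mul, hs, Matrix.sub_mul, Matrix.mul_sub, Matrix.mul_sub,
      e, h1, ← Matrix.mul_assoc, h1, C.isometry_conjTranspose_mul_self]
    simp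
  exact sub_eq_zero.1 (conjTranspose_mul_self_eq_zero.1 h0)

end Circuits

/-! ### Coherent use of an instrument. -/

section Instrument

/-- Weight `-1` on outcome `1` reads off minus the reflection; this is the origin of the minus signs
in the analysis of the attack. -/
theorem trace_sign_mul_instrument {a : Type} [Fintype a] [DecidableEq a] {P : Matrix a a ℂ}
    (hP : IsStarProjection P) (X : Matrix a a ℂ) :
    ((diagonal fun p : a × Bool => if p.2 then (-1 : ℂ) else 1) * instrument P X).trace =
      (-(2 * P - 1) * X).trace := by
  have h : ∀ r, (outcomeProj P r * X * outcomeProj P r).trace = (outcomeProj P r * X).trace := by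
    intro r
    rw [trace_mul_comm, ← Matrix.mul_assoc,
      (outcomeProj_isStarProjection hP r).isIdempotentElem.eq]
  calc _ = -(outcomeProj P true * X * outcomeProj P true).trace +
        (outcomeProj P false * X * outcomeProj P false).trace := by
        simp only [trace, diag_apply, diagonal_mul, instrument, LinearMap.coe_mk, AddHom.coe_mk,
          of_apply, if_true, Fintype.sum_prod_type, Fintype.sum_bool, Bool.false_eq_true, if_false,
          Finset.sum_add_distrib, neg_mul, one_mul, Finset.sum_neg_distrib]
    _ = _ := by
        rw [h, h, outcomeProj, outcomeProj, if_pos rfl, if_neg Bool.false_ne_true, neg_sub,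
          two_mul, sub_mul, sub_mul, add_mul, trace_sub, trace_sub, trace_add]
        ring

/-- The circuit may leave arbitrary garbage in its other wires. That is harmless: the statistics of
the outcome qubit already fix the overlap of `Z * J` with `J`, and a nearly unitary overlap forces
`Z * J` to be close to `-J * (2 * P - 1)`. -/
theorem norm_flip_isometry_add_le {m : ℕ} {C : Circuit} (h : m + 1 + 1 ≤ m + 1 + C.ancillas)
    {P : Matrix (Rej m) (Rej m) ℂ} (hP : IsStarProjection P) {ν : ℝ}
    (hC : DiamondNormLE (C.channel (m + 1) (m + 1 + 1) ∘ₗ conjMap (basisMap (encodeRej m)) -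
      conjMap (basisMap fun x : Rej m × Bool =>
        (Fin.cons x.2 (encodeRej m x.1) : Bits (m + 1 + 1))) ∘ₗ instrument P) ν) :
    ‖gatesMatrix (m + 1 + C.ancillas) flipGates * (C.isometry (m + 1) * encodeMatrix m) +
      C.isometry (m + 1) * encodeMatrix m * (2 * P - 1)‖ ≤ Real.sqrt (2 * ν) := by
  have hpos : 0 < m + 1 + C.ancillas := by omega
  set Z := gatesMatrix (m + 1 + C.ancillas) flipGates with hZ
  set J := C.isometry (m + 1) * encodeMatrix m with hJ
  have hJJ : Jᴴ * J = 1 := by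
    rw [hJ, conjTranspose_mul, Matrix.mul_assoc, ← Matrix.mul_assoc _ _ (encodeMatrix m),
      C.isometry_conjTranspose_mul_self, Matrix.one_mul, encodeMatrix_isometry]
  set f : Rej m × Bool → Bits (m + 1 + 1) := fun x => Fin.cons x.2 (encodeRej m x.1) with hf
  have hfi : Function.Injective f := fun x y hxy => by
    have := Fin.cons_injective2 hxy
    exact Prod.ext (encodeRej_injective m this.2) this.1
  set B : Matrix (Bits (m + 1 + 1)) (Bits (m + 1 + 1)) ℂ :=
    diagonal fun x => if x 0 then (-1 : ℂ) else 1 with hB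
  have hBn : ‖B‖ ≤ 1 := by
    exact norm_diagonal_ite_le _ (by simp) (by simp)
  have hlift : liftOp (Fin.castLE h) B = Z := by
    rw [hB, liftOp_diagonal, hZ, gatesMatrix_flipGates hpos]
    rfl
  have hdiag : (basisMap f)ᴴ * B * basisMap f =
      diagonal fun p : Rej m × Bool => if p.2 then (-1 : ℂ) else 1 := by
    rw [← submatrix_eq_basisMap, hB, submatrix_diagonal _ _ hfi]
    rfl
  have hreal := reflection_of_projection hP
  have hov : ‖Jᴴ * (Z * J) - -(2 * P - 1)‖ ≤ ν := by
    refine hC.norm_le hBn fun X => ?_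
    rw [LinearMap.sub_apply, Matrix.mul_sub, trace_sub, LinearMap.comp_apply,
      C.trace_mul_channel h, hlift, trace_mul_conjMap, LinearMap.comp_apply, trace_mul_conjMap,
      hdiag, trace_sign_mul_instrument hP, ← trace_sub, ← Matrix.sub_mul, hJ]
    simp only [conjTranspose_mul, encodeMatrix, Matrix.mul_assoc]
  have hO : (-(2 * P - 1))ᴴ * (-(2 * P - 1)) = 1 := by
    rw [← star_eq_conjTranspose, star_neg, hreal.1.star_eq, neg_mul_neg, hreal.2]
  have hZJ : (Z * J)ᴴ * (Z * J) = 1 := by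
    rw [conjTranspose_mul, Matrix.mul_assoc, ← Matrix.mul_assoc _ Z, hZ, gatesMatrix_unitary,
      Matrix.one_mul, hJJ]
  have := norm_sub_mul_le_of_overlap hZJ hJJ hO hov
  rwa [Matrix.mul_neg, sub_neg_eq_add] at this

end Instrument

/-! ### The attack and its effect on signed messages. -/

section Attack

/-- Wires below `k` stay in place, the other ones are moved by `s`. -/
def shiftAbove (k s i : ℕ) : ℕ := if i < k then i else i + s

theorem shiftAbove_injective (k s : ℕ) : Function.Injective (shiftAbove k s) := by
  intro i j h
  unfold shiftAbove at h
  split_ifs at h <;> omega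

theorem shiftAbove_lt {c a k b i : ℕ} (hi : i < k + b) :
    shiftAbove k (c + a) i < c + (a + (k + b)) := by
  unfold shiftAbove
  split_ifs <;> omega

/-- The attack: run the verification `Cv` coherently, flip the sign according to the outcome of the
measurement `Ci` of the message, and undo everything. -/
def attackCircuit (c k : ℕ) (Cv Ci : Circuit) : Circuit where
  inputs := c
  -- The instrument shares the first `k` wires with the verification output, and its wire `k + j`
  -- moves to `c + Cv.ancillas + k + j`. The `k` wires in between stay idle, which keeps the shift
  -- uniform.
  ancillas := Cv.ancillas + (k + Ci.ancillas)
  outputs := c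
  gates := Cv.gates ++ (Ci.gates.map (Gate.relabel (shiftAbove k (c + Cv.ancillas))) ++
    (flipGates ++ (invGates (Ci.gates.map (Gate.relabel (shiftAbove k (c + Cv.ancillas)))) ++
      invGates Cv.gates)))

theorem mem_invGates {g : Gate} {gs : List Gate} (h : g ∈ invGates gs) : ∃ g' ∈ gs, g = g'.inv := by
  simp only [invGates, List.mem_reverse, List.mem_map] at h
  obtain ⟨g', h1, h2⟩ := h
  exact ⟨g', h1, h2.symm⟩

theorem Gate.WellFormed.mono {k N : ℕ} {g : Gate} (h : g.WellFormed k) (hN : k ≤ N) :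
    g.WellFormed N := by
  rw [← Gate.relabel_id g]
  exact h.relabel Function.injective_id fun i hi => hi.trans_le hN

theorem attackCircuit_hasShape {c k : ℕ} {Cv Ci : Circuit} (hv : Cv.HasShape c k) {k' : ℕ}
    (hi : Ci.HasShape k k') (hk : 0 < k) : (attackCircuit c k Cv Ci).HasShape c c := by
  refine ⟨rfl, rfl, Nat.le_add_right _ _, fun g hg => ?_⟩
  have h1 : ∀ g ∈ Cv.gates, g.WellFormed (c + (Cv.ancillas + (k + Ci.ancillas))) := fun g hg =>
    (hv.2.2.2 g hg).mono (by omega)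
  have h2 : ∀ g ∈ Ci.gates.map (Gate.relabel (shiftAbove k (c + Cv.ancillas))),
      g.WellFormed (c + (Cv.ancillas + (k + Ci.ancillas))) := by
    intro g hg
    obtain ⟨g', hg', rfl⟩ := List.mem_map.1 hg
    exact (hi.2.2.2 g' hg').relabel (shiftAbove_injective _ _) fun i hi' =>
      shiftAbove_lt hi'
  simp only [attackCircuit, List.mem_append] at hg ⊢
  rcases hg with hg | hg | hg | hg | hg
  · exact h1 g hg
  · exact h2 g hg
  · rw [List.eq_of_mem_replicate hg]
    change 0 < _
    omega
  · obtain ⟨g', hg', rfl⟩ := mem_invGates hg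
    exact (h2 g' hg').inv
  · obtain ⟨g', hg', rfl⟩ := mem_invGates hg
    exact (h1 g' hg').inv

/-- By `hf2` the wires of `f` beyond the first `k` are fresh ancillas in state `|0⟩`. Once the first
`k` wires lie in the range of `g`, the input condition of the relabelled subcircuit thus holds
automatically. -/
theorem liftOp_range_mul_ancilla_mul_liftOp {k l n N : ℕ} {f : Fin (k + l) → Fin N}
    (hk : k ≤ n) (hf1 : ∀ i : Fin (k + l), i.val < k → (f i).val = i.val)
    (hf2 : ∀ i : Fin (k + l), k ≤ i.val → n ≤ (f i).val) {e : Type} [Fintype e] [DecidableEq e]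
    {g : e → Bits k} (hg : Function.Injective g) :
    liftOp f ((ancilla k (k + l) * basisMap g) * (ancilla k (k + l) * basisMap g)ᴴ) *
      (ancilla n N * liftOp (Fin.castLE hk) (basisMap g * (basisMap g)ᴴ)) =
    ancilla n N * liftOp (Fin.castLE hk) (basisMap g * (basisMap g)ᴴ) := by
  classical
  have h1 : Function.Injective (zeroExt k (k + l) ∘ g) :=
    (zeroExt_injective (Nat.le_add_right k l)).comp hg
  rw [ancilla, basisMap_mul_basisMap, basisMap_mul_conjTranspose h1 _ fun _ => Iff.rfl,
    basisMap_mul_conjTranspose hg _ fun _ => Iff.rfl, liftOp_diagonal, liftOp_diagonal, ancilla]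
  ext x y
  rw [diagonal_mul, mul_diagonal]
  by_cases hy : ∃ z, g z = y ∘ Fin.castLE hk
  · by_cases hx : x = zeroExt n N y
    · obtain ⟨z, hz⟩ := hy
      rw [if_pos, one_mul]
      refine ⟨z, ?_⟩
      subst hx
      funext i
      simp only [Function.comp_apply, hz, zeroExt]
      by_cases hi : i.val < k
      · have := hf1 i hi
        simp only [hi, dif_pos, this, hi.trans_le hk]
        rfl
      · have := hf2 i (not_lt.1 hi)
        rw [dif_neg hi, dif_neg (not_lt.2 this)]
    · have : basisMap (zeroExt n N) x y = 0 := if_neg hx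
      rw [this, zero_mul, mul_zero]
  · rw [if_neg hy, mul_zero, mul_zero]

variable {m c : ℕ} {Cv Ci : Circuit} {Ver : SuperOp (Bits c) (Rej m)}

/-- On signed states, the attack undoes the verification of the state to which the reflection has
been applied. -/
theorem norm_attack_isometry_add_le (hv : Cv.HasShape c (m + 1))
    (hVer : Cv.channel c (m + 1) = conjMap (encodeMatrix m) ∘ₗ Ver)
    (hi : Ci.HasShape (m + 1) (m + 1 + 1)) {P : Matrix (Rej m) (Rej m) ℂ}
    (hP : IsStarProjection P) {ν : ℝ}
    (hC : DiamondNormLE (Ci.channel (m + 1) (m + 1 + 1) ∘ₗ conjMap (basisMap (encodeRej m)) -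
      conjMap (basisMap fun x : Rej m × Bool =>
        (Fin.cons x.2 (encodeRej m x.1) : Bits (m + 1 + 1))) ∘ₗ instrument P) ν) :
    ‖(attackCircuit c (m + 1) Cv Ci).isometry c +
      ancilla (c + Cv.ancillas) (c + (attackCircuit c (m + 1) Cv Ci).ancillas) *
        ((gatesMatrix (c + Cv.ancillas) Cv.gates)ᴴ *
          (liftOp (Fin.castLE hv.2.2.1) (encodeOp (2 * P - 1)) * Cv.isometry c))‖ ≤
      Real.sqrt (2 * ν) := by
  have hk := hv.2.2.1
  set N := c + (attackCircuit c (m + 1) Cv Ci).ancillas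
  have hN : N = c + (Cv.ancillas + (m + 1 + Ci.ancillas)) := rfl
  have hle : c + Cv.ancillas ≤ N := by omega
  have hpos : 0 < m + 1 + Ci.ancillas := by omega
  let f : Fin (m + 1 + Ci.ancillas) → Fin N := fun i =>
    ⟨shiftAbove (m + 1) (c + Cv.ancillas) i.val, shiftAbove_lt i.2⟩
  have hf : Function.Injective f := fun i j hij =>
    Fin.ext (shiftAbove_injective _ _ (congrArg Fin.val hij))
  have hg : Function.Injective (Fin.castLE hle) := Fin.castLE_injective hle
  set U := gatesMatrix (c + Cv.ancillas) Cv.gates with hU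
  set G := gatesMatrix (m + 1 + Ci.ancillas) Ci.gates with hG
  set Z := gatesMatrix (m + 1 + Ci.ancillas) flipGates with hZ
  set V := Cv.isometry c with hV
  set K := ancilla (c + Cv.ancillas) N with hK
  set O : Matrix (Rej m) (Rej m) ℂ := 2 * P - 1 with hO
  set K₃ := ancilla (m + 1) (m + 1 + Ci.ancillas) with hK₃
  have hU' : gatesMatrix N Cv.gates = liftOp (Fin.castLE hle) U := by
    have := gatesMatrix_relabel hg (φ := fun i => i) (fun _ => rfl) Cv.gates hv.2.2.2
    rwa [List.map_congr_left (g := id) fun g _ => Gate.relabel_id g, List.map_id] at this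
  have hG' : gatesMatrix N (Ci.gates.map (Gate.relabel (shiftAbove (m + 1) (c + Cv.ancillas)))) =
      liftOp f G := gatesMatrix_relabel hf (fun _ => rfl) Ci.gates hi.2.2.2
  have hZ' : gatesMatrix N flipGates = liftOp f Z := by
    rw [hZ, gatesMatrix_flipGates hpos, liftOp_diagonal, gatesMatrix_flipGates (by omega)]
    rfl
  set W := Gᴴ * (Z * G) with hW
  have hiso : (attackCircuit c (m + 1) Cv Ci).isometry c =
      (liftOp (Fin.castLE hle) U)ᴴ * (liftOp f W * (K * V)) := by
    have h1 : (attackCircuit c (m + 1) Cv Ci).isometry c =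
        gatesMatrix N (attackCircuit c (m + 1) Cv Ci).gates * ancilla c N := rfl
    have h2 : K * V = liftOp (Fin.castLE hle) U * ancilla c N := by
      rw [hV, Circuit.isometry, ← Matrix.mul_assoc, ← liftOp_castLE_mul_ancilla hle,
        Matrix.mul_assoc, ancilla_mul_ancilla (Nat.le_add_right _ _)]
    rw [h1, h2]
    simp only [attackCircuit, gatesMatrix_append, gatesMatrix_invGates, hU', hG', hZ', hW,
      liftOp_mul hf, liftOp_conjTranspose, Matrix.mul_assoc]
    rfl
  have hrange : liftOp (Fin.castLE hk) (encodeOp 1) * V = V :=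
    liftOp_encodeOp_one_mul_isometry hk hVer
  set R := (K₃ * encodeMatrix m) * (K₃ * encodeMatrix m)ᴴ with hR
  have hRKV : liftOp f R * (K * V) = K * V := by
    have h1 : encodeOp 1 = encodeMatrix m * (encodeMatrix m)ᴴ := by
      rw [encodeOp, Matrix.mul_one]
    have h2 : liftOp f R * (K * liftOp (Fin.castLE hk) (encodeOp 1)) =
        K * liftOp (Fin.castLE hk) (encodeOp 1) := by
      rw [h1]
      exact liftOp_range_mul_ancilla_mul_liftOp hk
        (fun i hi => by simp only [f, shiftAbove, if_pos hi])
        (fun i hi => by simp only [f, shiftAbove, if_neg (not_lt.2 hi)]; omega)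
        (encodeRej_injective m)
    calc liftOp f R * (K * V)
        = liftOp f R * (K * liftOp (Fin.castLE hk) (encodeOp 1)) * V := by
          rw [Matrix.mul_assoc, Matrix.mul_assoc, hrange]
      _ = K * V := by rw [h2, Matrix.mul_assoc, hrange]
  set J := Ci.isometry (m + 1) * encodeMatrix m with hJ
  have hJ' : J = G * (K₃ * encodeMatrix m) := by
    rw [hJ, Circuit.isometry, Matrix.mul_assoc]
  set O' := liftOp (Fin.castLE (Nat.le_add_right (m + 1) Ci.ancillas)) (encodeOp O) with hO'
  have hO'K : O' * (K₃ * encodeMatrix m) = K₃ * encodeMatrix m * O := by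
    rw [← Matrix.mul_assoc, hO', liftOp_castLE_mul_ancilla, encodeOp, Matrix.mul_assoc,
      Matrix.mul_assoc _ _ (encodeMatrix m), encodeMatrix_isometry, Matrix.mul_one,
      Matrix.mul_assoc]
  have hGG : Gᴴ * G = 1 := gatesMatrix_unitary _ _
  -- The projector `R` restricts to valid inputs of the instrument circuit: encoded messages with
  -- zero ancillas. There the compute-flip-uncompute operator `W` is close to `-O'`, by the estimate
  -- for `Z * J + J * O`.
  have hD : (W + O') * R = Gᴴ * (Z * J + J * O) * (K₃ * encodeMatrix m)ᴴ := by
    rw [hR, ← Matrix.mul_assoc, Matrix.add_mul, hO'K, hJ', Matrix.mul_add, hW]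
    congr 2
    · simp only [Matrix.mul_assoc]
    · calc K₃ * encodeMatrix m * O = (Gᴴ * G) * (K₃ * encodeMatrix m * O) := by
            rw [hGG, Matrix.one_mul]
        _ = _ := by simp only [Matrix.mul_assoc]
  have hinst : ‖Z * J + J * O‖ ≤ Real.sqrt (2 * ν) := norm_flip_isometry_add_le hi.2.2.1 hP hC
  have hDn : ‖(W + O') * R‖ ≤ Real.sqrt (2 * ν) := by
    have h1 : ‖Gᴴ‖ ≤ 1 := by
      rw [l2_opNorm_conjTranspose]; exact norm_le_one_of_isometry hGG
    have h2 : ‖(K₃ * encodeMatrix m)ᴴ‖ ≤ 1 := by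
      rw [l2_opNorm_conjTranspose]
      refine norm_le_one_of_isometry ?_
      rw [conjTranspose_mul, Matrix.mul_assoc, ← Matrix.mul_assoc _ K₃,
        ancilla_isometry (Nat.le_add_right _ _), Matrix.one_mul, encodeMatrix_isometry]
    rw [hD]
    calc _ ≤ ‖Gᴴ‖ * ‖Z * J + J * O‖ * ‖(K₃ * encodeMatrix m)ᴴ‖ :=
          (l2_opNorm_mul _ _).trans (by gcongr; exact l2_opNorm_mul _ _)
      _ ≤ 1 * Real.sqrt (2 * ν) * 1 := by gcongr
      _ = _ := by ring
  have hO'f : liftOp f O' * K = K * liftOp (Fin.castLE hk) (encodeOp O) := by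
    have : f ∘ Fin.castLE (Nat.le_add_right (m + 1) Ci.ancillas) =
        Fin.castLE hle ∘ Fin.castLE hk := by
      funext i
      exact Fin.ext (if_pos i.2)
    rw [hO', liftOp_liftOp hf, this, ← liftOp_liftOp hg, liftOp_castLE_mul_ancilla]
  -- Since `R` fixes the verified state, it can be inserted for free, and the whole deviation
  -- factors through `(W + O') * R`.
  have htotal : (attackCircuit c (m + 1) Cv Ci).isometry c +
      K * (Uᴴ * (liftOp (Fin.castLE hk) (encodeOp O) * V)) =
      (liftOp (Fin.castLE hle) U)ᴴ * (liftOp f ((W + O') * R) * (K * V)) := by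
    rw [liftOp_mul hf, Matrix.mul_assoc (liftOp f (W + O')), hRKV, liftOp_add, Matrix.add_mul,
      Matrix.mul_add, ← hiso, ← Matrix.mul_assoc (liftOp f O'), hO'f, liftOp_conjTranspose]
    congr 1
    rw [← Matrix.mul_assoc K, ← liftOp_castLE_mul_ancilla hle]
    simp only [Matrix.mul_assoc]
    rfl
  rw [htotal]
  have h1 : ‖(liftOp (Fin.castLE hle) U)ᴴ‖ ≤ 1 := by
    rw [l2_opNorm_conjTranspose]
    exact (norm_liftOp_le hg U).trans (norm_le_one_of_isometry (gatesMatrix_unitary _ _))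
  have h2 : ‖K * V‖ ≤ 1 := by
    refine norm_le_one_of_isometry ?_
    rw [conjTranspose_mul, Matrix.mul_assoc, ← Matrix.mul_assoc _ K, ancilla_isometry hle,
      Matrix.one_mul, Cv.isometry_conjTranspose_mul_self]
  calc _ ≤ ‖(liftOp (Fin.castLE hle) U)ᴴ‖ * (‖liftOp f ((W + O') * R)‖ * ‖K * V‖) :=
        (l2_opNorm_mul _ _).trans (by gcongr; exact l2_opNorm_mul _ _)
    _ ≤ 1 * (Real.sqrt (2 * ν) * 1) := by
        gcongr
        exact (norm_liftOp_le hf _).trans hDn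
    _ = _ := by ring

/-- Pairing the outcome with its sign turns correctness into a statement about observables: the
reflection of `P`, pulled back through verification and signing, is nearly the reflection of its
compression. -/
theorem DiamondNormLE.norm_correctness_le {Cs : Circuit} {l : ℕ} (hs : Cs.HasShape l c)
    (hv : Cv.HasShape c (m + 1)) (hVer : Cv.channel c (m + 1) = conjMap (encodeMatrix m) ∘ₗ Ver)
    {V : Matrix (Rej m) (Bits l) ℂ} (hV : Vᴴ * V = 1) {P : Matrix (Rej m) (Rej m) ℂ} {ν : ℝ}
    (h : DiamondNormLE (outcomeMap P ∘ₗ Ver ∘ₗ Cs.channel l c - outcomeMap P ∘ₗ conjMap V) ν) :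
    ‖(Cs.dilation l c)ᴴ * tensorOne (Bits (l + Cs.ancillas - c)) ((Cv.isometry c)ᴴ *
      liftOp (Fin.castLE hv.2.2.1) (encodeOp (2 * P - 1)) * Cv.isometry c) * Cs.dilation l c -
        (2 * (Vᴴ * P * V) - 1)‖ ≤ ν := by
  refine h.norm_le (B := outcomeSign) (norm_diagonal_ite_le _ (by simp) (by simp)) fun X => ?_
  rw [LinearMap.sub_apply, Matrix.mul_sub, trace_sub, LinearMap.comp_apply, LinearMap.comp_apply,
    LinearMap.comp_apply, trace_outcomeSign_mul_outcomeMap, trace_outcomeSign_mul_outcomeMap,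
    trace_mul_of_encoded hv.2.2.1 hVer, Cs.trace_mul_channel_dilation hs.2.2.1, trace_mul_conjMap,
    Matrix.sub_mul, trace_sub]
  congr 4
  rw [Matrix.mul_sub, Matrix.sub_mul, Matrix.mul_one, hV, two_mul, two_mul, Matrix.mul_add,
    Matrix.add_mul]

/-- Against the attack, the verified observable of `Q` is the observable of `Q` conjugated by the
reflection of `P`. -/
theorem exists_attack_observable {Cs : Circuit} {l : ℕ} (hs : Cs.HasShape l c)
    (hv : Cv.HasShape c (m + 1)) (hVer : Cv.channel c (m + 1) = conjMap (encodeMatrix m) ∘ₗ Ver)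
    (hi : Ci.HasShape (m + 1) (m + 1 + 1)) {P Q : Matrix (Rej m) (Rej m) ℂ}
    (hP : IsStarProjection P) (hQ : IsStarProjection Q) {ν ν' : ℝ}
    (hC : DiamondNormLE (Ci.channel (m + 1) (m + 1 + 1) ∘ₗ conjMap (basisMap (encodeRej m)) -
      conjMap (basisMap fun x : Rej m × Bool =>
        (Fin.cons x.2 (encodeRej m x.1) : Bits (m + 1 + 1))) ∘ₗ instrument P) ν)
    {V : Matrix (Rej m) (Bits l) ℂ} (hV : Vᴴ * V = 1)
    (hP' : IsStarProjection (Vᴴ * P * V))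
    (hcP : DiamondNormLE (outcomeMap P ∘ₗ Ver ∘ₗ Cs.channel l c - outcomeMap P ∘ₗ conjMap V) ν')
    (hcQ : DiamondNormLE (outcomeMap Q ∘ₗ Ver ∘ₗ Cs.channel l c - outcomeMap Q ∘ₗ conjMap V) ν') :
    ∃ E : Matrix (Bits l) (Bits l) ℂ,
      (∀ X, ((2 * Q - 1) * Ver ((attackCircuit c (m + 1) Cv Ci).channel c c
        (Cs.channel l c X))).trace = (E * X).trace) ∧
      ‖E - (2 * (Vᴴ * P * V) - 1) * (2 * (Vᴴ * Q * V) - 1) * (2 * (Vᴴ * P * V) - 1)‖ ≤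
        2 * (Real.sqrt (2 * ν) + Real.sqrt (2 * ν')) + ν' := by
  have hk := hv.2.2.1
  have hA := attackCircuit_hasShape hv hi (Nat.succ_pos m)
  set e := Bits (l + Cs.ancillas - c)
  set S := Cs.dilation l c with hS
  set T := (attackCircuit c (m + 1) Cv Ci).isometry c with hT
  set K := ancilla c (c + (attackCircuit c (m + 1) Cv Ci).ancillas) with hK
  set K₂ := ancilla (c + Cv.ancillas) (c + (attackCircuit c (m + 1) Cv Ci).ancillas) with hK₂
  set U := gatesMatrix (c + Cv.ancillas) Cv.gates with hU
  set W := Cv.isometry c with hW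
  set O₀ := 2 * (Vᴴ * P * V) - 1 with hO₀
  set O₁ := 2 * (Vᴴ * Q * V) - 1 with hO₁
  set OP := liftOp (Fin.castLE hk) (encodeOp (2 * P - 1)) with hOP
  set e₁ := Wᴴ * liftOp (Fin.castLE hk) (encodeOp (2 * Q - 1)) * W with he₁
  set L := liftOp (Fin.castLE hA.2.2.1) e₁ with hL
  have hSS : Sᴴ * S = 1 := Cs.dilation_conjTranspose_mul_self hs.2.2.1
  have hWW : Wᴴ * W = 1 := Cv.isometry_conjTranspose_mul_self c
  have hTT : Tᴴ * T = 1 := Circuit.isometry_conjTranspose_mul_self _ c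
  have hKK : Kᴴ * K = 1 := ancilla_isometry (Nat.le_add_right _ _)
  have hle : c + Cv.ancillas ≤ c + (attackCircuit c (m + 1) Cv Ci).ancillas := by
    simp only [attackCircuit]; omega
  -- Undoing an undisturbed verification returns the signed state with all ancillas reset.
  have hKW : K₂ * (Uᴴ * W) = K := by
    rw [hW, Circuit.isometry, ← Matrix.mul_assoc _ _ (ancilla _ _), hU, gatesMatrix_unitary,
      Matrix.one_mul, hK₂, ancilla_mul_ancilla (Nat.le_add_right _ _)]
  have hrP := reflection_of_projection hP
  have hrQ := reflection_of_projection hQ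
  have hrP' : IsSelfAdjoint O₀ ∧ O₀ * O₀ = 1 := reflection_of_projection hP'
  have hstep : ∀ {x y : Type} [Fintype x] [DecidableEq x] [Fintype y] [DecidableEq y]
      (A : Matrix x y ℂ) (B : Matrix (y × e) (Bits l) ℂ), Aᴴ * A = 1 → Bᴴ * B = 1 →
      (tensorOne e A * B)ᴴ * (tensorOne e A * B) = 1 := by
    intro x y _ _ _ _ A B h1 h2
    rw [conjTranspose_mul, Matrix.mul_assoc, ← Matrix.mul_assoc _ (tensorOne e A),
      tensorOne_conjTranspose, ← tensorOne_mul, h1, tensorOne_one, Matrix.one_mul, h2]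
  -- On qubits `OP` squares only to the code space projector, which suffices because that projector
  -- fixes `W`.
  have hOPW : (OP * W)ᴴ * (OP * W) = 1 := by
    have h1 : OPᴴ * OP = liftOp (Fin.castLE hk) (encodeOp 1) := by
      rw [hOP, liftOp_conjTranspose, ← liftOp_mul (Fin.castLE_injective hk),
        encodeOp_conjTranspose, encodeOp_mul, ← star_eq_conjTranspose, hrP.1.star_eq, hrP.2]
    rw [conjTranspose_mul, Matrix.mul_assoc, ← Matrix.mul_assoc _ OP, h1,
      liftOp_encodeOp_one_mul_isometry hk hVer, hWW]
  -- Reflecting the verified message is nearly the same as reflecting the message before signing.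
  -- Correctness supplies the overlap of the two isometries, hence the square root.
  have hcorrP : ‖tensorOne e (OP * W) * S - tensorOne e W * S * O₀‖ ≤ Real.sqrt (2 * ν') := by
    refine norm_sub_mul_le_of_overlap (hstep _ _ hOPW hSS) (hstep _ _ hWW hSS) ?_ ?_
    · rw [← star_eq_conjTranspose, hrP'.1.star_eq, hrP'.2]
    · have h1 := hcP.norm_correctness_le hs hv hVer hV
      have h2 : (tensorOne e W * S)ᴴ * (tensorOne e (OP * W) * S) =
          Sᴴ * tensorOne e (Wᴴ * OP * W) * S := by
        rw [conjTranspose_mul, tensorOne_conjTranspose, Matrix.mul_assoc Wᴴ, tensorOne_mul e Wᴴ]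
        simp only [Matrix.mul_assoc]
      rw [h2]
      exact h1
  have hcorrQ : ‖Sᴴ * tensorOne e e₁ * S - O₁‖ ≤ ν' := hcQ.norm_correctness_le hs hv hVer hV
  clear_value O₀ O₁
  have hattack := norm_attack_isometry_add_le hv hVer hi hP hC
  have hKU : ‖K₂ * Uᴴ‖ ≤ 1 := by
    have h1 : ‖K₂‖ ≤ 1 := norm_le_one_of_isometry (ancilla_isometry hle)
    have h2 : ‖Uᴴ‖ ≤ 1 := by
      rw [l2_opNorm_conjTranspose]
      exact norm_le_one_of_isometry (gatesMatrix_unitary _ _)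
    exact (l2_opNorm_mul _ _).trans (mul_le_one₀ h1 (norm_nonneg _) h2)
  -- Two replacements are made: the coherent instrument by the exact reflection, and the reflection
  -- after verification by `O₀` before signing.
  have hclose : ‖tensorOne e T * S - -(tensorOne e K * S * O₀)‖ ≤
      Real.sqrt (2 * ν) + Real.sqrt (2 * ν') := by
    have h1 : tensorOne e T * S - -(tensorOne e K * S * O₀) =
        tensorOne e (T + K₂ * (Uᴴ * (OP * W))) * S -
          tensorOne e (K₂ * Uᴴ) * (tensorOne e (OP * W) * S - tensorOne e W * S * O₀) := by
      have h2 : tensorOne e (K₂ * Uᴴ) * (tensorOne e W * S * O₀) = tensorOne e K * S * O₀ := by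
        rw [← hKW, ← Matrix.mul_assoc K₂, tensorOne_mul e _ W]
        simp only [Matrix.mul_assoc]
      have h3 : tensorOne e (K₂ * Uᴴ) * (tensorOne e (OP * W) * S) =
          tensorOne e (K₂ * (Uᴴ * (OP * W))) * S := by
        rw [← Matrix.mul_assoc K₂, tensorOne_mul e _ (OP * W), Matrix.mul_assoc]
      rw [Matrix.mul_sub, h2, h3, tensorOne_add, Matrix.add_mul]
      abel
    rw [h1]
    refine (norm_sub_le _ _).trans (add_le_add ?_ ?_)
    · calc _ ≤ ‖tensorOne e (T + K₂ * (Uᴴ * (OP * W)))‖ * ‖S‖ := l2_opNorm_mul _ _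
        _ ≤ Real.sqrt (2 * ν) * 1 := by
          gcongr
          · exact (norm_tensorOne_le _ _).trans hattack
          · exact norm_le_one_of_isometry hSS
        _ = _ := mul_one _
    · calc _ ≤ ‖tensorOne e (K₂ * Uᴴ)‖ * ‖tensorOne e (OP * W) * S - tensorOne e W * S * O₀‖ :=
            l2_opNorm_mul _ _
        _ ≤ 1 * Real.sqrt (2 * ν') := by
          gcongr
          exact (norm_tensorOne_le _ _).trans hKU
        _ = _ := one_mul _
  have hO₀n : ‖O₀‖ ≤ 1 := norm_le_one_of_reflection hrP'.1 hrP'.2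
  have hLn : ‖tensorOne e L‖ ≤ 1 := by
    refine (norm_tensorOne_le _ _).trans ((norm_liftOp_le (Fin.castLE_injective _) _).trans ?_)
    have h1 : ‖W‖ ≤ 1 := norm_le_one_of_isometry hWW
    have h2 : ‖liftOp (Fin.castLE hk) (encodeOp (2 * Q - 1))‖ ≤ 1 :=
      (norm_liftOp_le (Fin.castLE_injective _) _).trans
        ((norm_encodeOp_le _).trans (norm_le_one_of_reflection hrQ.1 hrQ.2))
    calc _ ≤ ‖Wᴴ‖ * ‖liftOp (Fin.castLE hk) (encodeOp (2 * Q - 1))‖ * ‖W‖ :=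
          (l2_opNorm_mul _ _).trans (by gcongr; exact l2_opNorm_mul _ _)
      _ ≤ 1 * 1 * 1 := by rw [l2_opNorm_conjTranspose]; gcongr
      _ = 1 := by norm_num
  have hKLK : Kᴴ * L * K = e₁ := by
    rw [hL, Matrix.mul_assoc, hK, liftOp_castLE_mul_ancilla, ← Matrix.mul_assoc, hKK,
      Matrix.one_mul]
  -- The global sign of the attack cancels in the sandwich, which leaves the honest observable of
  -- `Q` conjugated by `O₀`.
  have hideal : (-(tensorOne e K * S * O₀))ᴴ * tensorOne e L * -(tensorOne e K * S * O₀) =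
      O₀ * (Sᴴ * tensorOne e e₁ * S) * O₀ := by
    rw [← hKLK, tensorOne_mul e _ K, tensorOne_mul e _ L, conjTranspose_neg, Matrix.neg_mul,
      Matrix.neg_mul, Matrix.mul_neg, neg_neg, conjTranspose_mul, conjTranspose_mul,
      tensorOne_conjTranspose, ← star_eq_conjTranspose O₀, hrP'.1.star_eq]
    simp only [Matrix.mul_assoc]
  refine ⟨(tensorOne e T * S)ᴴ * tensorOne e L * (tensorOne e T * S), fun X => ?_, ?_⟩
  · rw [trace_mul_of_encoded hk hVer, Circuit.trace_mul_channel _ hA.2.2.1,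
      Cs.trace_mul_channel_dilation hs.2.2.1, tensorOne_mul _ _ T, tensorOne_mul _ _ L,
      ← tensorOne_conjTranspose, conjTranspose_mul]
    simp only [Matrix.mul_assoc]
    rfl
  · have h1 := norm_sandwich_sub_le (norm_le_one_of_isometry (hstep _ _ hTT hSS))
      (B := -(tensorOne e K * S * O₀)) (by
        rw [norm_neg]
        refine (l2_opNorm_mul _ _).trans (mul_le_one₀ ?_ (norm_nonneg _) hO₀n)
        exact norm_le_one_of_isometry (hstep _ _ hKK hSS)) hLn hclose
    have h2 : ‖O₀ * (Sᴴ * tensorOne e e₁ * S) * O₀ - O₀ * O₁ * O₀‖ ≤ ν' := by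
      have : O₀ * (Sᴴ * tensorOne e e₁ * S) * O₀ - O₀ * O₁ * O₀ =
          O₀ * (Sᴴ * tensorOne e e₁ * S - O₁) * O₀ := by
        rw [Matrix.mul_sub, Matrix.sub_mul]
      rw [this]
      calc _ ≤ ‖O₀‖ * ‖Sᴴ * tensorOne e e₁ * S - O₁‖ * ‖O₀‖ :=
            (l2_opNorm_mul _ _).trans (by gcongr; exact l2_opNorm_mul _ _)
        _ ≤ 1 * ν' * 1 := by
            gcongr
            rw [one_mul]
            exact (norm_nonneg _).trans hcorrQ
        _ = ν' := by ring
    rw [hideal] at h1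
    exact (norm_sub_le_norm_sub_add_norm_sub _ _ _).trans (add_le_add h1 h2)

end Attack

/-! ### Closure properties of polynomial time. -/

section PolynomialTime

theorem monotone_eval (q : Polynomial ℕ) : Monotone fun n => q.eval n := by
  intro m n h
  simp only [Polynomial.eval_eq_sum_range]
  exact Finset.sum_le_sum fun i _ => Nat.mul_le_mul_left _ (Nat.pow_le_pow_left h i)

theorem Data.one_le_size (d : Data) : 1 ≤ d.size := by
  cases d <;> simp [Data.size]

/-- The first component (`nil` for a leaf). -/
def Data.fst : Data → Data
  | .nil => .nil
  | .cons a _ => a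

/-- The second component (`nil` for a leaf). -/
def Data.snd : Data → Data
  | .nil => .nil
  | .cons _ b => b

/-- `a` if `c` is a leaf, and `b` otherwise. -/
def Data.cond (c a b : Data) : Data :=
  match c with
  | .nil => a
  | .cons _ _ => b

/-- Every step is charged at least the size of its argument, so cost bounds output size. This is
what makes compositions polynomial. -/
theorem Runs.size_le {p : Prog} {d e : Data} {t : ℕ} (h : Runs p d e t) :
    d.size ≤ t ∧ e.size ≤ t := by
  induction h with
  | id d => exact ⟨le_rfl, le_rfl⟩
  | nil d => exact ⟨le_rfl, d.one_le_size⟩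
  | fst_nil => exact ⟨le_rfl, le_rfl⟩
  | fst_cons a b => simp only [Data.size]; omega
  | snd_nil => exact ⟨le_rfl, le_rfl⟩
  | snd_cons a b => simp only [Data.size]; omega
  | @pair p q d a b s t _ _ ih1 ih2 =>
    have := d.one_le_size
    simp only [Data.size]; omega
  | comp _ _ ih1 ih2 => omega
  | branch_nil _ _ ih1 ih2 => omega
  | branch_cons _ _ ih1 ih2 => omega
  | loop_stop _ ih => omega
  | loop_step _ _ _ ih1 ih2 ih3 => omega

/-- The function is computed by a program in time polynomial in the size of the argument. -/
def PolyTime (f : Data → Data) : Prop :=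
  ∃ (p : Prog) (q : Polynomial ℕ), ∀ d, ∃ t ≤ q.eval d.size, Runs p d (f d) t

theorem PolyTime.size_le {f : Data → Data} (h : PolyTime f) :
    ∃ q : Polynomial ℕ, ∀ d, (f d).size ≤ q.eval d.size := by
  obtain ⟨p, q, h⟩ := h
  refine ⟨q, fun d => ?_⟩
  obtain ⟨t, ht, hr⟩ := h d
  exact hr.size_le.2.trans ht

theorem PolyTime.id : PolyTime fun d => d :=
  ⟨.id, .X, fun d => ⟨d.size, by simp, .id d⟩⟩

theorem PolyTime.pair {f g : Data → Data} (hf : PolyTime f) (hg : PolyTime g) :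
    PolyTime fun d => .cons (f d) (g d) := by
  obtain ⟨p, q, h⟩ := hf
  obtain ⟨p', q', h'⟩ := hg
  refine ⟨.pair p p', q + q' + .X, fun d => ?_⟩
  obtain ⟨t, ht, hr⟩ := h d
  obtain ⟨t', ht', hr'⟩ := h' d
  exact ⟨_, by simp only [Polynomial.eval_add, Polynomial.eval_X]; omega, .pair hr hr'⟩

theorem PolyTime.comp {f g : Data → Data} (hg : PolyTime g) (hf : PolyTime f) :
    PolyTime fun d => g (f d) := by
  obtain ⟨p, q, h⟩ := hf
  obtain ⟨p', q', h'⟩ := hg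
  refine ⟨.comp p p', q + q'.comp q + .X, fun d => ?_⟩
  obtain ⟨t, ht, hr⟩ := h d
  obtain ⟨t', ht', hr'⟩ := h' (f d)
  have := monotone_eval q' (hr.size_le.2.trans ht)
  simp only at this
  exact ⟨_, by simp only [Polynomial.eval_add, Polynomial.eval_X, Polynomial.eval_comp]; omega,
    .comp hr hr'⟩

theorem PolyTime.fst {f : Data → Data} (hf : PolyTime f) : PolyTime fun d => (f d).fst := by
  refine PolyTime.comp (g := Data.fst) ⟨.fst, .X, fun d => ⟨d.size, by simp, ?_⟩⟩ hf
  cases d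
  · exact .fst_nil
  · exact .fst_cons _ _

theorem PolyTime.snd {f : Data → Data} (hf : PolyTime f) : PolyTime fun d => (f d).snd := by
  refine PolyTime.comp (g := Data.snd) ⟨.snd, .X, fun d => ⟨d.size, by simp, ?_⟩⟩ hf
  cases d
  · exact .snd_nil
  · exact .snd_cons _ _

theorem PolyTime.const (e : Data) : PolyTime fun _ => e := by
  induction e with
  | nil => exact ⟨.nil, .X, fun d => ⟨d.size, by simp, .nil d⟩⟩
  | cons a b iha ihb => exact iha.pair ihb

theorem PolyTime.cond {c f g : Data → Data} (hc : PolyTime c) (hf : PolyTime f)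
    (hg : PolyTime g) : PolyTime fun d => (c d).cond (f d) (g d) := by
  obtain ⟨p, q, h⟩ := hc
  obtain ⟨p₁, q₁, h₁⟩ := hf
  obtain ⟨p₂, q₂, h₂⟩ := hg
  refine ⟨.branch p p₁ p₂, q + q₁ + q₂ + .X, fun d => ?_⟩
  obtain ⟨t, ht, hr⟩ := h d
  obtain ⟨t₁, ht₁, hr₁⟩ := h₁ d
  obtain ⟨t₂, ht₂, hr₂⟩ := h₂ d
  simp only [Polynomial.eval_add, Polynomial.eval_X]
  cases hcd : c d with
  | nil =>
    rw [hcd] at hr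
    exact ⟨_, by omega, .branch_nil hr hr₁⟩
  | cons a b =>
    rw [hcd] at hr
    exact ⟨_, by omega, .branch_cons hr hr₂⟩

/-- Run through the list `l`, and update the accumulator by `g` of the entry, the environment and
the accumulator. -/
def foldEnv (g : Data → Data) : Data → Data → Data → Data
  | .nil, _, a => a
  | .cons h l, e, a => foldEnv g l e (g (.cons h (.cons e a)))

/-- One step enlarges the accumulator by at most an amount independent of the accumulator, which
rules out exponential growth over the iterations. -/
theorem PolyTime.foldEnv {g f₁ f₂ f₃ : Data → Data} (hg : PolyTime g) {B : Polynomial ℕ}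
    (hB : ∀ h e a, (g (.cons h (.cons e a))).size ≤ a.size + B.eval (h.size + e.size))
    (h₁ : PolyTime f₁) (h₂ : PolyTime f₂) (h₃ : PolyTime f₃) :
    PolyTime fun d => foldEnv g (f₁ d) (f₂ d) (f₃ d) := by
  have hbody : PolyTime fun S => .cons S.fst.snd (.cons S.snd.fst (g (.cons S.fst.fst S.snd))) :=
    PolyTime.id.fst.snd.pair (PolyTime.id.snd.fst.pair
      (hg.comp (PolyTime.id.fst.fst.pair PolyTime.id.snd)))
  obtain ⟨p, q, hp⟩ := hbody
  -- `M` bounds the state throughout the loop, with `L` a fixed bound on the initial list. Each pass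
  -- shortens the list, whose size pays for the growth of the accumulator, and costs at most `q.eval
  -- M + 2 * M`.
  have hloop : ∀ (e : Data) (L M : ℕ) (l a : Data), l.size ≤ L →
      l.size + e.size + a.size + l.size * B.eval (L + e.size) + 2 ≤ M →
      ∃ t ≤ l.size * (q.eval M + 2 * M),
        Runs (.loop p) (.cons l (.cons e a)) (.cons .nil (.cons e (QSig.foldEnv g l e a))) t := by
    intro e L M l
    induction l with
    | nil =>
      intro a _ hM
      refine ⟨_, ?_, Runs.loop_stop (.fst_cons _ _)⟩
      simp only [Data.size] at hM ⊢
      have : 0 ≤ q.eval M := Nat.zero_le _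
      omega
    | cons h l _ ih =>
      intro a hL hM
      simp only [Data.size] at hL hM
      have hstep := hB h e a
      have hmono := monotone_eval B (show h.size + e.size ≤ L + e.size by omega)
      simp only at hmono
      have hmul : (h.size + l.size + 1) * B.eval (L + e.size) =
          h.size * B.eval (L + e.size) + l.size * B.eval (L + e.size) + B.eval (L + e.size) := by
        ring
      obtain ⟨t, ht, hr⟩ := ih (g (.cons h (.cons e a))) (by omega) (by
        have : 0 ≤ h.size * B.eval (L + e.size) := Nat.zero_le _
        omega)
      obtain ⟨s, hs, hrs⟩ := hp (.cons (.cons h l) (.cons e a))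
      have hS : (Data.cons (.cons h l) (.cons e a)).size ≤ M := by
        simp only [Data.size]
        have : 0 ≤ (h.size + l.size + 1) * B.eval (L + e.size) := Nat.zero_le _
        omega
      have hq := monotone_eval q hS
      simp only at hq
      refine ⟨_, ?_, .loop_step (.fst_cons _ _) hrs hr⟩
      have hexp : (Data.cons h l).size * (q.eval M + 2 * M) =
          h.size * (q.eval M + 2 * M) + l.size * (q.eval M + 2 * M) + (q.eval M + 2 * M) := by
        simp only [Data.size]; ring
      have : 0 ≤ h.size * (q.eval M + 2 * M) := Nat.zero_le _
      omega
  obtain ⟨q₁, hq₁⟩ := h₁.size_le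
  obtain ⟨q₂, hq₂⟩ := h₂.size_le
  obtain ⟨q₃, hq₃⟩ := h₃.size_le
  obtain ⟨p', q', hp'⟩ := h₁.pair (h₂.pair h₃)
  let M : Polynomial ℕ := q₁ + q₂ + q₃ + q₁ * B.comp (q₁ + q₂) + 2
  have hrun : PolyTime fun d =>
      .cons .nil (.cons (f₂ d) (QSig.foldEnv g (f₁ d) (f₂ d) (f₃ d))) := by
    refine ⟨.comp p' (.loop p), q' + q₁ * (q.comp M + 2 * M) + .X, fun d => ?_⟩
    obtain ⟨t', ht', hr'⟩ := hp' d
    have hBm := monotone_eval B (add_le_add_right (hq₂ d) (q₁.eval d.size))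
    simp only at hBm
    obtain ⟨t, ht, hr⟩ := hloop (f₂ d) (q₁.eval d.size) (M.eval d.size) (f₁ d) (f₃ d) (hq₁ d) (by
      simp only [M, Polynomial.eval_add, Polynomial.eval_mul, Polynomial.eval_comp,
        Polynomial.eval_ofNat]
      have := Nat.mul_le_mul (hq₁ d) hBm
      have h1 := hq₁ d
      have h2 := hq₂ d
      have h3 := hq₃ d
      omega)
    refine ⟨_, ?_, .comp hr' hr⟩
    have := Nat.mul_le_mul_right (q.eval (M.eval d.size) + 2 * M.eval d.size) (hq₁ d)
    simp only [Polynomial.eval_add, Polynomial.eval_mul, Polynomial.eval_comp,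
      Polynomial.eval_ofNat, Polynomial.eval_X]
    omega
  exact hrun.snd.snd

end PolynomialTime

/-! ### Programs for lists and unary arithmetic. -/

section Lists

/-- Apply `φ` to the entries of the list `l` and to the environment `e`, and put the results in
reverse order in front of the list `a`. -/
def revMapData (φ : Data → Data) (l e a : Data) : Data :=
  foldEnv (fun S => .cons (φ (.cons S.fst S.snd.fst)) S.snd.snd) l e a

theorem PolyTime.revMapData {φ f₁ f₂ f₃ : Data → Data} (hφ : PolyTime φ) (h₁ : PolyTime f₁)
    (h₂ : PolyTime f₂) (h₃ : PolyTime f₃) :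
    PolyTime fun d => revMapData φ (f₁ d) (f₂ d) (f₃ d) := by
  obtain ⟨q, hq⟩ := hφ.size_le
  refine PolyTime.foldEnv (B := q.comp (.X + 1) + 1) ((hφ.comp (PolyTime.id.fst.pair
    PolyTime.id.snd.fst)).pair PolyTime.id.snd.snd) (fun h e a => ?_) h₁ h₂ h₃
  have := hq (.cons h e)
  simp only [Data.size, Data.fst, Data.snd, Polynomial.eval_add, Polynomial.eval_comp,
    Polynomial.eval_X, Polynomial.eval_one] at this ⊢
  omega

theorem revMapData_encList {α β : Type} {enc : α → Data} {enc' : β → Data} {φ : Data → Data}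
    {ψ : α → β} {e : Data} (l : List α) (h : ∀ x ∈ l, φ (.cons (enc x) e) = enc' (ψ x))
    (a : List β) : revMapData φ (encList enc l) e (encList enc' a) =
      encList enc' ((l.map ψ).reverse ++ a) := by
  induction l generalizing a with
  | nil => rfl
  | cons x l ih =>
    have h1 : revMapData φ (encList enc (x :: l)) e (encList enc' a) =
        revMapData φ (encList enc l) e (.cons (φ (.cons (enc x) e)) (encList enc' a)) := rfl
    rw [h1, h x List.mem_cons_self]
    have := ih (fun y hy => h y (List.mem_cons_of_mem _ hy)) (ψ x :: a)
    rw [encList] at this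
    rw [this]
    simp

/-- Concatenation of lists. -/
def appendData (l a : Data) : Data :=
  -- Each pass reverses, so two passes restore the order; `Data.fst` drops the environment.
  revMapData Data.fst (revMapData Data.fst l .nil .nil) .nil a

theorem PolyTime.appendData {f g : Data → Data} (hf : PolyTime f) (hg : PolyTime g) :
    PolyTime fun d => appendData (f d) (g d) :=
  PolyTime.revMapData PolyTime.id.fst (PolyTime.revMapData PolyTime.id.fst hf (.const _) (.const _))
    (.const _) hg

theorem appendData_encList {α : Type} (enc : α → Data) (l a : List α) :
    appendData (encList enc l) (encList enc a) = encList enc (l ++ a) := by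
  have h1 := revMapData_encList (enc := enc) (enc' := enc) (φ := Data.fst) (ψ := fun x => x)
    (e := .nil) l (fun _ _ => rfl) []
  have h2 := revMapData_encList (enc := enc) (enc' := enc) (φ := Data.fst) (ψ := fun x => x)
    (e := .nil) (l.reverse) (fun _ _ => rfl) a
  simp only [List.map_id', List.append_nil, List.reverse_reverse] at h1 h2
  rw [appendData, show Data.nil = encList enc [] from rfl]
  rw [show revMapData Data.fst (encList enc l) (encList enc []) (encList enc []) = _ from h1]
  exact h2

theorem encNat_eq_encList (n : ℕ) : encNat n = encList (fun _ : Unit => .nil) (.replicate n ()) := by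
  induction n with
  | zero => rfl
  | succ n ih => rw [encNat, ih]; rfl

theorem appendData_encNat (m n : ℕ) : appendData (encNat m) (encNat n) = encNat (m + n) := by
  rw [encNat_eq_encList, encNat_eq_encList, encNat_eq_encList, appendData_encList,
    List.replicate_append_replicate]

/-- Truncated subtraction of unary numbers. -/
def subData (a b : Data) : Data := foldEnv (fun S => S.snd.snd.snd) b .nil a

theorem PolyTime.subData {f g : Data → Data} (hf : PolyTime f) (hg : PolyTime g) :
    PolyTime fun d => subData (f d) (g d) := by
  refine PolyTime.foldEnv (B := 0) PolyTime.id.snd.snd.snd (fun h e a => ?_) hg (.const _) hf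
  cases a <;> simp only [Data.snd, Data.size] <;> omega

theorem subData_encNat (m n : ℕ) : subData (encNat m) (encNat n) = encNat (m - n) := by
  induction n generalizing m with
  | zero => rfl
  | succ n ih =>
    have h : subData (encNat m) (encNat (n + 1)) = subData (encNat m).snd (encNat n) := rfl
    rw [h]
    cases m with
    | zero => exact (ih 0).trans (by simp)
    | succ m => exact (ih m).trans (by simp)

end Lists

/-! ### The attack circuit is computed in polynomial time. -/

section GateData

/-- `shiftAbove` on unary numbers, with the two parameters in the environment. -/
def shiftData (i e : Data) : Data := (subData e.fst i).cond (appendData i e.snd) i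

theorem PolyTime.shiftData {f g : Data → Data} (hf : PolyTime f) (hg : PolyTime g) :
    PolyTime fun d => shiftData (f d) (g d) :=
  (hg.fst.subData hf).cond (hf.appendData hg.snd) hf

theorem shiftData_encNat (k s i : ℕ) :
    shiftData (encNat i) (.cons (encNat k) (encNat s)) = encNat (shiftAbove k s i) := by
  simp only [shiftData, Data.fst, Data.snd, subData_encNat, appendData_encNat, shiftAbove]
  split_ifs with h
  · obtain ⟨j, hj⟩ := Nat.exists_eq_succ_of_ne_zero (Nat.sub_ne_zero_of_lt h)
    rw [hj]
    rfl
  · rw [Nat.sub_eq_zero_of_le (not_lt.1 h)]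
    rfl

/-- `Gate.relabel` for `shiftAbove`, on a pair of a gate and an environment. -/
def relabelData (D : Data) : Data :=
  -- Two steps down the unary tag something remains only for tag `3`, the controlled not, which
  -- carries two wires.
  .cons D.fst.fst (D.fst.fst.snd.snd.cond (shiftData D.fst.snd D.snd)
    (.cons (shiftData D.fst.snd.fst D.snd) (shiftData D.fst.snd.snd D.snd)))

theorem PolyTime.relabelData : PolyTime relabelData :=
  PolyTime.id.fst.fst.pair (PolyTime.id.fst.fst.snd.snd.cond
    (PolyTime.id.fst.snd.shiftData PolyTime.id.snd)
    ((PolyTime.id.fst.snd.fst.shiftData PolyTime.id.snd).pair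
      (PolyTime.id.fst.snd.snd.shiftData PolyTime.id.snd)))

theorem relabelData_encGate (k s : ℕ) (g : Gate) :
    relabelData (.cons (encGate g) (.cons (encNat k) (encNat s))) =
      encGate (g.relabel (shiftAbove k s)) := by
  cases g <;>
    simp only [relabelData, encGate, Data.fst, Data.snd, encNat, Data.cond, Gate.relabel,
      shiftData_encNat]

/-- `Gate.inv`, on a pair of a gate and an unused environment. -/
def invData (D : Data) : Data :=
  -- Tags `1` and `2` (`T` and `T†`) are exchanged; tags `0` and `3` are self-inverse.
  D.fst.fst.cond D.fst (D.fst.fst.snd.cond (.cons (encNat 2) D.fst.snd)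
    (D.fst.fst.snd.snd.cond (.cons (encNat 1) D.fst.snd) D.fst))

theorem PolyTime.invData : PolyTime invData :=
  PolyTime.id.fst.fst.cond PolyTime.id.fst (PolyTime.id.fst.fst.snd.cond
    ((PolyTime.const _).pair PolyTime.id.fst.snd) (PolyTime.id.fst.fst.snd.snd.cond
      ((PolyTime.const _).pair PolyTime.id.fst.snd) PolyTime.id.fst))

theorem invData_encGate (e : Data) (g : Gate) :
    invData (.cons (encGate g) e) = encGate g.inv := by
  cases g <;> simp only [invData, encGate, Data.fst, Data.snd, encNat, Data.cond, Gate.inv]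

/-- The inverse of a list of gates. -/
def invGatesData (gs : Data) : Data := revMapData invData gs .nil .nil

theorem invGatesData_encList (gs : List Gate) :
    invGatesData (encList encGate gs) = encList encGate (invGates gs) := by
  have := revMapData_encList (enc := encGate) (enc' := encGate) (e := .nil) gs
    (fun g _ => invData_encGate .nil g) []
  rw [List.append_nil] at this
  exact this

/-- Renumbering of the wires of a list of gates, with the parameters in the environment. -/
def relabelGatesData (gs e : Data) : Data :=
  revMapData Data.fst (revMapData relabelData gs e .nil) .nil .nil

theorem relabelGatesData_encList (k s : ℕ) (gs : List Gate) :
    relabelGatesData (encList encGate gs) (.cons (encNat k) (encNat s)) =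
      encList encGate (gs.map (Gate.relabel (shiftAbove k s))) := by
  have h1 := revMapData_encList (enc := encGate) (enc' := encGate) gs
    (fun g _ => relabelData_encGate k s g) []
  have h2 := revMapData_encList (enc := encGate) (enc' := encGate) (φ := Data.fst)
    (ψ := fun x => x) (e := .nil) (gs.map (Gate.relabel (shiftAbove k s))).reverse
    (fun _ _ => rfl) []
  simp only [List.map_id', List.append_nil, List.reverse_reverse] at h1 h2
  exact (congrArg (fun l => revMapData Data.fst l .nil .nil) h1).trans h2

/-- `attackCircuit`, on a pair of circuits. -/
def attackData (D : Data) : Data :=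
  let c := D.fst.fst
  let a := D.fst.snd.fst
  let k := D.fst.snd.snd.fst
  let gv := D.fst.snd.snd.snd
  let gi := relabelGatesData D.snd.snd.snd.snd (.cons k (appendData c a))
  .cons c (.cons (appendData a (appendData k D.snd.snd.fst)) (.cons c
    (appendData gv (appendData gi (appendData (encList encGate flipGates)
      (appendData (invGatesData gi) (invGatesData gv)))))))

theorem PolyTime.attackData : PolyTime attackData := by
  have hv := PolyTime.id.fst
  have hi := PolyTime.id.snd
  have hgi := PolyTime.revMapData PolyTime.id.fst (PolyTime.revMapData PolyTime.relabelData
    hi.snd.snd.snd (hv.snd.snd.fst.pair (hv.fst.appendData hv.snd.fst)) (.const .nil))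
    (.const .nil) (.const .nil)
  exact hv.fst.pair ((hv.snd.fst.appendData (hv.snd.snd.fst.appendData hi.snd.fst)).pair
    (hv.fst.pair (hv.snd.snd.snd.appendData (hgi.appendData ((PolyTime.const _).appendData
      ((PolyTime.invData.revMapData hgi (.const .nil) (.const .nil)).appendData
        (PolyTime.invData.revMapData hv.snd.snd.snd (.const .nil) (.const .nil))))))))

theorem attackData_encCircuit (Cv Ci : Circuit) :
    attackData (.cons (encCircuit Cv) (encCircuit Ci)) =
      encCircuit (attackCircuit Cv.inputs Cv.outputs Cv Ci) := by
  simp only [attackData, encCircuit, Data.fst, Data.snd, appendData_encNat,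
    relabelGatesData_encList, invGatesData_encList, appendData_encList, attackCircuit]

/-- The wire numbers are read from the encoding of `Cv n k` itself, so they need not be computed
separately. -/
theorem polyTimeUniform_attackCircuit {l : ℕ → ℕ} {Cv : ∀ n, Bits (l n) → Circuit}
    {Ci : ℕ → Circuit} (hv : PolyTimeUniform Cv) (hi : PolyTimeUniform₀ Ci) :
    PolyTimeUniform fun n k =>
      attackCircuit (Cv n k).inputs (Cv n k).outputs (Cv n k) (Ci n) := by
  obtain ⟨pv, qv, hv⟩ := hv
  obtain ⟨pi, qi, hi⟩ := hi
  obtain ⟨pa, qa, ha⟩ := PolyTime.attackData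
  -- The instrument's program expects an empty key, so the key is replaced by `nil`. In `7 * qv`,
  -- one share is the run of `pv`; the other six pay for the steps charged with the size of the
  -- input.
  refine ⟨.comp (.pair pv (.comp (.pair .fst .nil) pi)) pa,
    7 * qv + qi + qa.comp (qv + qi + 1), fun n k => ?_⟩
  obtain ⟨tv, htv, hrv⟩ := hv n k
  obtain ⟨ti, hti, hri⟩ := hi n fun _ => false
  obtain ⟨ta, hta, hra⟩ := ha (.cons (encCircuit (Cv n k)) (encCircuit (Ci n)))
  rw [attackData_encCircuit] at hra
  rw [List.ofFn_zero] at hri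
  refine ⟨_, ?_, .comp (.pair hrv (.comp (.pair (.fst_cons _ _) (.nil _)) hri)) hra⟩
  have hsize : (Data.cons (encCircuit (Cv n k)) (encCircuit (Ci n))).size ≤
      qv.eval n + qi.eval n + 1 := by
    have h1 := hrv.size_le.2
    have h2 : (encCircuit (Ci n)).size ≤ ti := hri.size_le.2
    simp only [Data.size]
    omega
  have hqa := monotone_eval qa hsize
  have hd := hrv.size_le.1
  simp only [Polynomial.eval_add, Polynomial.eval_mul, Polynomial.eval_comp,
    Polynomial.eval_ofNat, Polynomial.eval_one] at hqa ⊢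
  omega

end GateData

/-! ### Arithmetic of negligible functions. -/

section Negligible

/-- `n ^ c * √ν = √(n ^ (2 * c) * ν)`, so decay at exponent `2 * c` gives decay at exponent `c`. -/
theorem Negligible.sqrt {ν : ℕ → ℝ} (h : Negligible ν) : Negligible fun n => Real.sqrt (ν n) := by
  intro c
  have h1 := (h (2 * c)).sqrt
  rw [Real.sqrt_zero] at h1
  refine h1.congr fun n => ?_
  rw [Real.sqrt_mul (by positivity), mul_comm 2 c, pow_mul, Real.sqrt_sq (by positivity)]

theorem Negligible.add {ν μ : ℕ → ℝ} (h : Negligible ν) (h' : Negligible μ) :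
    Negligible fun n => ν n + μ n :=
  Asymptotics.SuperpolynomialDecay.add h h'

theorem Negligible.const_mul {ν : ℕ → ℝ} (h : Negligible ν) (c : ℝ) :
    Negligible fun n => c * ν n :=
  Asymptotics.SuperpolynomialDecay.const_mul h c

end Negligible

/-! ### Compression to the message space and the value on reject. -/

section Compression

variable {m : ℕ} {P : Matrix (Rej m) (Rej m) ℂ}

theorem messageMatrix_isometry (m : ℕ) :
    (basisMap (some : Bits m → Rej m))ᴴ * basisMap (some : Bits m → Rej m) = 1 :=
  basisMap_conjTranspose_mul_self (Option.some_injective _)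

theorem apply_reject_message (h : Commute P (Matrix.single none none 1)) (x : Bits m) :
    P none (some x) = 0 := by
  have := congrFun (congrFun h.eq none) (some x)
  simpa using this.symm

/-- Commuting with `|⊥⟩⟨⊥|` kills the matrix entries between messages and `⊥`, so the message space
is invariant. -/
theorem mul_messageMatrix (h : Commute P (Matrix.single none none 1)) :
    P * basisMap (some : Bits m → Rej m) = basisMap (some : Bits m → Rej m) *
      ((basisMap (some : Bits m → Rej m))ᴴ * P * basisMap (some : Bits m → Rej m)) := by
  rw [← submatrix_eq_basisMap]
  ext i y
  rw [mul_basisMap_apply]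
  cases i with
  | none => simp [mul_apply, basisMap, apply_reject_message h]
  | some x => simp [mul_apply, basisMap]

theorem compression_isStarProjection (hP : IsStarProjection P)
    (h : Commute P (Matrix.single none none 1)) :
    IsStarProjection ((basisMap (some : Bits m → Rej m))ᴴ * P *
      basisMap (some : Bits m → Rej m)) := by
  constructor
  · rw [IsIdempotentElem]
    conv_lhs => rw [Matrix.mul_assoc _ (basisMap some), ← mul_messageMatrix h]
    rw [← Matrix.mul_assoc, Matrix.mul_assoc _ P P, hP.isIdempotentElem.eq]
  · rw [IsSelfAdjoint, star_eq_conjTranspose, conjTranspose_mul, conjTranspose_mul,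
      conjTranspose_conjTranspose, ← star_eq_conjTranspose P, hP.isSelfAdjoint.star_eq,
      Matrix.mul_assoc]

/-- The entry of `P` at `⊥` is an idempotent scalar, so a rejected state has a deterministic
outcome. The one-sided comparison with the mixture relies on this. -/
theorem reflection_reject (hP : IsStarProjection P) (h : Commute P (Matrix.single none none 1)) :
    ∃ o : ℝ, (o = 1 ∨ o = -1) ∧
      (2 * P - 1 : Matrix (Rej m) (Rej m) ℂ) none none = (o : ℂ) := by
  have h1 := congrFun (congrFun hP.isIdempotentElem.eq none) none
  rw [mul_apply, Fintype.sum_option, Finset.sum_eq_zero fun x _ => by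
    rw [apply_reject_message h, zero_mul], add_zero] at h1
  have h2 : (2 * P - 1 : Matrix (Rej m) (Rej m) ℂ) none none = 2 * P none none - 1 := by
    rw [two_mul, Matrix.sub_apply, Matrix.add_apply, one_apply_eq, two_mul]
  rcases IsIdempotentElem.iff_eq_zero_or_one.1 (show IsIdempotentElem (P none none) from h1) with h3 | h3
  · exact ⟨-1, Or.inr rfl, by rw [h2, h3]; simp⟩
  · exact ⟨1, Or.inl rfl, by rw [h2, h3]; norm_num⟩

theorem trace_mul_rejectMap (B : Matrix (Rej m) (Rej m) ℂ) (X : Matrix (Bits m) (Bits m) ℂ) :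
    (B * rejectMap m X).trace = B none none * X.trace := by
  change (B * (X.trace • Matrix.single none none 1)).trace = _
  rw [Matrix.mul_smul, trace_smul, Matrix.trace_mul_single, smul_eq_mul, mul_comm]
  simp

end Compression

/-! ### Averaging over keys, and the conclusion. -/

theorem sum_toReal_pmf {a : Type} [Fintype a] (p : PMF a) : ∑ k, (p k).toReal = 1 := by
  rw [← ENNReal.toReal_sum fun k _ => p.apply_ne_top k, ← tsum_fintype (L := .unconditional _),
    p.tsum_coe, ENNReal.toReal_one]

-- The factor `4` from the outcome pairs is the one that relates the commutators of projections and
-- reflections, so the security error enters with constant exactly `1`.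
open scoped MatrixOrder in
theorem traceNorm_orders_le_of_secure {m : ℕ} {P Q : Matrix (Rej m) (Rej m) ℂ}
    (hP : IsStarProjection P) (hPr : Commute P (Matrix.single none none 1))
    (hQ : IsStarProjection Q) (hQr : Commute Q (Matrix.single none none 1))
    {Φ : SuperOp (Bits m) (Rej m)} {E : Matrix (Bits m) (Bits m) ℂ}
    (hE : ∀ X, ((2 * Q - 1) * Φ X).trace = (E * X).trace) {η δ p : ℝ} (hp : p ≤ 1)
    (hη : ‖E - (2 * ((basisMap (some : Bits m → Rej m))ᴴ * P * basisMap some) - 1) *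
      (2 * ((basisMap (some : Bits m → Rej m))ᴴ * Q * basisMap some) - 1) *
      (2 * ((basisMap (some : Bits m → Rej m))ᴴ * P * basisMap some) - 1)‖ ≤ η)
    (h : DiamondNormLE (outcomeMap Q ∘ₗ Φ - ((p : ℂ) • (outcomeMap Q ∘ₗ inclusion m) +
      ((1 - p : ℝ) : ℂ) • (outcomeMap Q ∘ₗ rejectMap m))) δ)
    {r : Type} [Fintype r] [DecidableEq r] {ρ : Matrix (Bits m × r) (Bits m × r) ℂ}
    (hρ : ρ.PosSemidef) (htr : ρ.trace = 1) :
    traceNorm (ampliate r (zeroThenOne P Q ∘ₗ inclusion m) ρ -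
      ampliate r (oneThenZero P Q ∘ₗ inclusion m) ρ) ≤ δ + η := by
  have hV := messageMatrix_isometry m
  have hP' := compression_isStarProjection hP hPr
  have hQ' := compression_isStarProjection hQ hQr
  refine (traceNorm_measure_orders_le hV (mul_messageMatrix hPr) (mul_messageMatrix hQr) hP' hQ'
    hρ htr).trans ((four_mul_norm_commutator_le hP').trans ?_)
  set V := basisMap (some : Bits m → Rej m) with hVdef
  obtain ⟨o, ho, hoQ⟩ := reflection_reject hQ hQr
  have hrP := reflection_of_projection hP'
  have hrQ := reflection_of_projection hQ'
  have hDO : 2 * (Vᴴ * Q * V) - 1 = Vᴴ * (2 * Q - 1) * V := by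
    rw [Matrix.mul_sub, Matrix.sub_mul, Matrix.mul_one, hV, two_mul, two_mul, Matrix.mul_add,
      Matrix.add_mul]
  -- Security in the Heisenberg picture: honest delivery contributes the compressed reflection of
  -- `Q`, and rejection the scalar `o`.
  have hD : ‖E - ((p : ℂ) • (2 * (Vᴴ * Q * V) - 1) +
      ((1 - p : ℝ) : ℂ) • ((o : ℂ) • (1 : Matrix (Bits m) (Bits m) ℂ)))‖ ≤ δ := by
    refine h.norm_le (B := outcomeSign) (norm_diagonal_ite_le _ (by simp) (by simp)) fun X => ?_
    have h1 : (outcomeSign * outcomeMap Q (inclusion m X)).trace =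
        ((2 * (Vᴴ * Q * V) - 1) * X).trace := by
      rw [trace_outcomeSign_mul_outcomeMap, inclusion, trace_mul_conjMap, hDO]
    have h2 : (outcomeSign * outcomeMap Q (rejectMap m X)).trace = (o : ℂ) * X.trace := by
      rw [trace_outcomeSign_mul_outcomeMap, trace_mul_rejectMap, hoQ]
    have h3 : (outcomeSign * outcomeMap Q (Φ X)).trace = (E * X).trace := by
      rw [trace_outcomeSign_mul_outcomeMap, hE]
    simp only [LinearMap.sub_apply, LinearMap.add_apply, LinearMap.smul_apply,
      LinearMap.comp_apply, Matrix.mul_sub, Matrix.mul_add, Matrix.mul_smul, trace_sub, trace_add,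
      trace_smul, h1, h2, h3]
    conv_rhs =>
      rw [Matrix.sub_mul, Matrix.add_mul, Matrix.smul_mul, Matrix.smul_mul, Matrix.smul_mul,
        Matrix.one_mul, trace_sub, trace_add, trace_smul, trace_smul, trace_smul]
    rfl
  refine norm_conj_sub_le_of_mixture hrP.1 hrQ.1 hrP.2 hrQ.2 hp ho ?_
  rw [Complex.coe_smul, Complex.coe_smul, Complex.coe_smul] at hD
  rw [norm_sub_rev] at hη
  exact (norm_sub_le_norm_sub_add_norm_sub _ E _).trans ((add_le_add hη hD).trans_eq (add_comm η δ))

/-- The target `G` does not depend on the key, so the average of the observables is as close to it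
as each single one. -/
theorem Scheme.exists_average_observable (S : Scheme) (n : ℕ)
    (A : Bits (S.lv n) → SuperOp (Bits (S.c n)) (Bits (S.c n)))
    {O : Matrix (Rej (S.m n)) (Rej (S.m n)) ℂ} {G : Matrix (Bits (S.m n)) (Bits (S.m n)) ℂ} {η : ℝ}
    (h : ∀ k ∈ (S.keyGen n).support, ∃ E : Matrix (Bits (S.m n)) (Bits (S.m n)) ℂ,
      (∀ X, (O * S.ver n k.2 (A k.2 (S.sign n k.1 X))).trace = (E * X).trace) ∧ ‖E - G‖ ≤ η) :
    ∃ E : Matrix (Bits (S.m n)) (Bits (S.m n)) ℂ,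
      (∀ X, (O * S.attack n A X).trace = (E * X).trace) ∧ ‖E - G‖ ≤ η := by
  -- Keys of probability zero get the observable `0`; their weight vanishes.
  have h' : ∀ k, ∃ E : Matrix (Bits (S.m n)) (Bits (S.m n)) ℂ, S.keyGen n k ≠ 0 →
      (∀ X, (O * S.ver n k.2 (A k.2 (S.sign n k.1 X))).trace = (E * X).trace) ∧ ‖E - G‖ ≤ η := by
    intro k
    by_cases hk : S.keyGen n k = 0
    · exact ⟨0, fun h0 => absurd hk h0⟩
    · obtain ⟨E, hE⟩ := h k ((PMF.mem_support_iff _ _).2 hk)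
      exact ⟨E, fun _ => hE⟩
  choose E hE using h'
  have hw := sum_toReal_pmf (S.keyGen n)
  refine ⟨∑ k, (((S.keyGen n k).toReal : ℝ) : ℂ) • E k, fun X => ?_, ?_⟩
  · rw [Scheme.attack, LinearMap.sum_apply, Matrix.mul_sum, trace_sum, Matrix.sum_mul, trace_sum]
    refine Finset.sum_congr rfl fun k _ => ?_
    rw [LinearMap.smul_apply, Matrix.mul_smul, trace_smul, Matrix.smul_mul, trace_smul]
    by_cases hk : S.keyGen n k = 0
    · simp [hk]
    · rw [← (hE k hk).1 X]
      rfl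
  · have hG : G = ∑ k, (((S.keyGen n k).toReal : ℝ) : ℂ) • G := by
      rw [← Finset.sum_smul, ← Complex.ofReal_sum, hw, Complex.ofReal_one, one_smul]
    have hη : η = ∑ k, (S.keyGen n k).toReal * η := by rw [← Finset.sum_mul, hw, one_mul]
    rw [hG, hη, ← Finset.sum_sub_distrib]
    refine (norm_sum_le _ _).trans (Finset.sum_le_sum fun k _ => ?_)
    rw [← smul_sub, norm_smul, Complex.norm_real, Real.norm_of_nonneg ENNReal.toReal_nonneg]
    by_cases hk : S.keyGen n k = 0
    · simp [hk]
    · exact mul_le_mul_of_nonneg_left (hE k hk).2 ENNReal.toReal_nonneg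

theorem Scheme.traceNorm_orders_le (S : Scheme) (n : ℕ) (M₀ M₁ : TwoOutcome S.m)
    {Cs : Bits (S.ls n) → Circuit} {Cv : Bits (S.lv n) → Circuit} {Ci : Circuit}
    (hs : ∀ k, (Cs k).HasShape (S.m n) (S.c n) ∧ (Cs k).channel (S.m n) (S.c n) = S.sign n k)
    (hv : ∀ k, (Cv k).HasShape (S.c n) (S.m n + 1) ∧
      (Cv k).channel (S.c n) (S.m n + 1) = conjMap (basisMap (encodeRej (S.m n))) ∘ₗ S.ver n k)
    (hi : Ci.HasShape (S.m n + 1) (S.m n + 1 + 1)) {ν ν' δ p : ℝ}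
    (hC : DiamondNormLE
      (Ci.channel (S.m n + 1) (S.m n + 1 + 1) ∘ₗ conjMap (basisMap (encodeRej (S.m n))) -
        conjMap (basisMap fun x : Rej (S.m n) × Bool =>
          (Fin.cons x.2 (encodeRej (S.m n) x.1) : Bits (S.m n + 1 + 1))) ∘ₗ
            instrument (M₀.proj n)) ν)
    (hc : ∀ N ∈ ({M₀, M₁} : Set (TwoOutcome S.m)), ∀ k ∈ (S.keyGen n).support,
      DiamondNormLE (outcomeMap (N.proj n) ∘ₗ S.ver n k.2 ∘ₗ S.sign n k.1 -
        outcomeMap (N.proj n) ∘ₗ inclusion (S.m n)) ν')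
    (hp : p ≤ 1)
    (hD : DiamondNormLE (outcomeMap (M₁.proj n) ∘ₗ S.attack n (fun vk =>
        (attackCircuit (S.c n) (S.m n + 1) (Cv vk) Ci).channel (S.c n) (S.c n)) -
      ((p : ℂ) • (outcomeMap (M₁.proj n) ∘ₗ inclusion (S.m n)) +
        ((1 - p : ℝ) : ℂ) • (outcomeMap (M₁.proj n) ∘ₗ rejectMap (S.m n)))) δ)
    {r : Type} [Fintype r] [DecidableEq r]
    {ρ : Matrix (Bits (S.m n) × r) (Bits (S.m n) × r) ℂ}
    (hρ : ρ.PosSemidef) (htr : ρ.trace = 1) :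
    traceNorm
        (ampliate r (zeroThenOne (M₀.proj n) (M₁.proj n) ∘ₗ inclusion (S.m n)) ρ -
          ampliate r (oneThenZero (M₀.proj n) (M₁.proj n) ∘ₗ inclusion (S.m n)) ρ) ≤
      δ + (2 * (Real.sqrt (2 * ν) + Real.sqrt (2 * ν')) + ν') := by
  obtain ⟨E, hE, hEn⟩ := S.exists_average_observable n (fun vk =>
      (attackCircuit (S.c n) (S.m n + 1) (Cv vk) Ci).channel (S.c n) (S.c n))
    (O := 2 * M₁.proj n - 1)
    (G := (2 * ((basisMap (some : Bits (S.m n) → Rej (S.m n)))ᴴ * M₀.proj n * basisMap some) - 1) *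
      (2 * ((basisMap (some : Bits (S.m n) → Rej (S.m n)))ᴴ * M₁.proj n * basisMap some) - 1) *
      (2 * ((basisMap (some : Bits (S.m n) → Rej (S.m n)))ᴴ * M₀.proj n * basisMap some) - 1))
    (η := 2 * (Real.sqrt (2 * ν) + Real.sqrt (2 * ν')) + ν') (fun k hk => by
      have hcP := hc M₀ (by simp) k hk
      have hcQ := hc M₁ (by simp) k hk
      rw [← (hs k.1).2] at hcP hcQ ⊢
      exact exists_attack_observable (hs k.1).1 (hv k.2).1 (hv k.2).2 hi
        (M₀.isStarProjection n) (M₁.isStarProjection n) hC (messageMatrix_isometry _)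
        (compression_isStarProjection (M₀.isStarProjection n) (M₀.commute_reject n)) hcP hcQ)
  exact traceNorm_orders_le_of_secure (M₀.isStarProjection n) (M₀.commute_reject n)
    (M₁.isStarProjection n) (M₁.commute_reject n) hE hp hEn hD hρ htr

end QSig

open QSig
theorem mainTheorem1 (S : Scheme) (M₀ M₁ : TwoOutcome S.m) (ε : ℕ → ℝ)
    (hM₀ : M₀.EfficientInstrument) (hM₁ : M₁.EfficientInstrument)
    (hcorrect : S.CorrectFor {M₀, M₁})
    (hsecure : S.OneTimeSecureFor ε {M₀, M₁}) :
    ∃ ν : ℕ → ℝ, Negligible ν ∧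
      ∀ (r : ℕ → ℕ) (ρ : ∀ n, Matrix (Bits (S.m n) × Bits (r n)) (Bits (S.m n) × Bits (r n)) ℂ),
        EfficientlyPreparable S.m r ρ → ∀ n,
          traceNorm
            (ampliate (Bits (r n))
                (zeroThenOne (M₀.proj n) (M₁.proj n) ∘ₗ inclusion (S.m n)) (ρ n) -
              ampliate (Bits (r n))
                (oneThenZero (M₀.proj n) (M₁.proj n) ∘ₗ inclusion (S.m n)) (ρ n)) ≤
            ε n + ν n := by
  obtain ⟨Ci, hCi, νi, hνi, hi⟩ := hM₀
  obtain ⟨Cs, -, hs⟩ := S.sign_qpt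
  obtain ⟨Cv, hCv, hv⟩ := S.ver_qpt
  obtain ⟨νc, hνc, hc⟩ := hcorrect
  let A : ∀ n, Bits (S.lv n) → SuperOp (Bits (S.c n)) (Bits (S.c n)) := fun n vk =>
    (attackCircuit (S.c n) (S.m n + 1) (Cv n vk) (Ci n)).channel (S.c n) (S.c n)
  have hA : IsQPT A := by
    refine ⟨_, polyTimeUniform_attackCircuit hCv hCi, fun n k => ?_⟩
    rw [(hv n k).1.1, (hv n k).1.2.1]
    exact ⟨attackCircuit_hasShape (hv n k).1 (hi n).1 (Nat.succ_pos _), rfl⟩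
  -- The attack reflects with `M₀`, so it is the statistics of `M₁` that betray a failure to
  -- commute.
  obtain ⟨νs, hνs, hsec⟩ := hsecure A hA M₁ (by simp)
  refine ⟨fun n => νs n + (2 * (Real.sqrt (2 * νi n) + Real.sqrt (2 * νc n)) + νc n),
    hνs.add ((((hνi.const_mul 2).sqrt.add (hνc.const_mul 2).sqrt).const_mul 2).add hνc),
    fun r ρ hρ n => ?_⟩
  obtain ⟨p, -, hp, hD⟩ := hsec n
  have := S.traceNorm_orders_le n M₀ M₁ (hs n) (hv n) (hi n).1 (hi n).2
    (fun N hN k hk => hc N hN n k hk) hp hD (hρ.1 n).1 (hρ.1 n).2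
  linarith
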